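/- Let $\Gamma$ be a countably infinite discrete amenable group acting continuously on a compact metrizable space $X$. Here $\Gamma$ is amenable if for every nonempty finite $K\subseteq\Gamma$ and every $\varepsilon>0$ there is a nonempty finite $F\subseteq\Gamma$ with $|KF\,\Delta\, F|<\varepsilon|F|$. For an action of $\Gamma$ on a topological space $Y$, an integer $k\ge 1$ and a tuple $(A_1,\dots,A_k)$ of subsets of $Y$, a set $F\subseteq\Gamma$ is called an independence set for $(A_1,\dots,A_k)$ if $\bigcap_{s\in J}s^{-1}A_{\sigma(s)}\neq\emptyset$ for every nonempty finite $J\subseteq F$ and every map $\sigma:J\to\{1,\dots,k\}$. The independence density of $(A_1,\dots,A_k)$ is the infimum, over all nonempty finite $F\subseteq\Gamma$, of $$\frac{1}{|F|}\max\{|J| : J\subseteq F\text{ is an independence set for }(A_1,\dots,A_k)\}.$$ A tuple $(y_1,\dots,y_k)\in Y^k$ is an IE-tuple if $(U_1,\dots,U_k)$ has positive independence density whenever each $U_j$ is a neighborhood of $y_j$; the set of all IE-tuples of length $k$ is denoted by $\mathrm{IE}_k(Y)$. Let $\mathcal M(X)$ be the space of Borel probability measures on $X$ with the weak$^*$-topology,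 on which $\Gamma$ acts by push-forward. Identify $\mathcal M(X)$ with a subset of the dual $C(X)^*$ of the space of continuous real-valued functions on $X$, with the weak$^*$-topology, via $\mu\mapsto\bigl(f\mapsto\int_X f\,d\mu\bigr)$, so that $\mathcal M(X)^k\subseteq (C(X)^*)^k$, and identify $X$ with a subset of $\mathcal M(X)$ via $x\mapsto\delta_x$, so that $X^k\subseteq\mathcal M(X)^k$. For $\mu\in\mathcal M(X^k)$ and $1\le j\le k$ let $\mu^{(j)}\in\mathcal M(X)$ be the push-forward of $\mu$ under the $j$-th coordinate map; Borel probability measures on $\mathrm{IE}_k(X)$ are regarded as Borel probability measures on $X^k$ by push-forward under the inclusion. Theorem. For every integer $k\ge1$ the following hold. 1. $\mathrm{IE}_k(\mathcal M(X))$ is the closed convex hull of $\mathrm{IE}_k(X)$ in $\mathcal M(X)^k$. 2. $\mathrm{IE}_k(X)=\mathrm{IE}_k(\mathcal M(X))\cap X^k$, and this set is the set of extreme points of $\mathrm{IE}_k(\mathcal M(X))$. 3. $\mathrm{IE}_k(\mathcal M(X))=\{(\mu^{(1)},\dots,\mu^{(k)}) : \mu\in\mathcal M(\mathrm{IE}_k(X))\}$.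 -/

import Mathlib

open MeasureTheory Topology
open scoped Pointwise symmDiff

open Classical in
/-- A discrete group is amenable if it satisfies the Følner condition: for every nonempty finite
`K ⊆ Γ` and every `ε > 0` there is a nonempty finite `F ⊆ Γ` with `|KF ∆ F| < ε |F|`. -/
def IsAmenableGroup (Γ : Type*) [Group Γ] : Prop :=
  ∀ K : Finset Γ, K.Nonempty → ∀ ε : ℝ, 0 < ε →
    ∃ F : Finset Γ, F.Nonempty ∧ (((K * F) ∆ F).card : ℝ) < ε * (F.card : ℝ)

/-- `F ⊆ Γ` is an independence set for a tuple `A` of subsets of `Y` if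
`⋂_{s ∈ J} s⁻¹ A_{σ(s)}` is nonempty for every nonempty finite `J ⊆ F` and every `σ : J → [k]`. -/
def IsIndependenceSet {Γ Y : Type*} [Group Γ] [MulAction Γ Y] {k : ℕ}
    (A : Fin k → Set Y) (F : Set Γ) : Prop :=
  ∀ J : Finset Γ, J.Nonempty → (J : Set Γ) ⊆ F → ∀ σ : J → Fin k,
    (⋂ s : J, (fun y : Y => (s : Γ) • y) ⁻¹' A (σ s)).Nonempty

open Classical in
/-- The maximal cardinality of an independence set for `A` contained in `F`. -/
noncomputable def maxIndependentCard (Γ : Type*) {Y : Type*} [Group Γ] [MulAction Γ Y] {k : ℕ}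
    (A : Fin k → Set Y) (F : Finset Γ) : ℕ :=
  (F.powerset.filter (fun J : Finset Γ => IsIndependenceSet A (J : Set Γ))).sup Finset.card

/-- The independence density of `A`: the infimum, over all nonempty finite `F ⊆ Γ`, of
the maximal proportion of `F` occupied by an independence set. -/
noncomputable def independenceDensity (Γ : Type*) {Y : Type*} [Group Γ] [MulAction Γ Y] {k : ℕ}
    (A : Fin k → Set Y) : ℝ :=
  ⨅ F : {F : Finset Γ // F.Nonempty},
    (maxIndependentCard Γ A F.1 : ℝ) / (F.1.card : ℝ)

/-- The set of IE-tuples of length `k` of the action of `Γ` on `Y`. -/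
def IETuples (Γ : Type*) (k : ℕ) (Y : Type*) [Group Γ] [TopologicalSpace Y] [MulAction Γ Y] :
    Set (Fin k → Y) :=
  {y | ∀ U : Fin k → Set Y, (∀ j, U j ∈ 𝓝 (y j)) → 0 < independenceDensity Γ U}

/-- The induced action on probability measures: `s • μ` is the push-forward of `μ` under
`x ↦ s • x`. -/
noncomputable instance probabilityMeasureMulAction {Γ X : Type*} [Group Γ] [MeasurableSpace X]
    [MulAction Γ X] [MeasurableConstSMul Γ X] : MulAction Γ (ProbabilityMeasure X) where
  smul s μ := μ.map (f := fun x : X => s • x) (measurable_const_smul s).aemeasurable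
  one_smul μ := by
    apply Subtype.ext
    change (μ : Measure X).map (fun x : X => (1 : Γ) • x) = (μ : Measure X)
    simp
  mul_smul s t μ := by
    apply Subtype.ext
    change (μ : Measure X).map (fun x : X => (s * t) • x) =
      ((μ : Measure X).map (fun x : X => t • x)).map (fun x : X => s • x)
    rw [Measure.map_map (measurable_const_smul s) (measurable_const_smul t)]
    congr 1
    funext x
    exact mul_smul s t x

/-- The identification of a Borel probability measure `μ` with the functional `f ↦ ∫ f dμ` in the
dual of `C(X)`, which carries the weak-* topology. -/
noncomputable def measureFunctional {X : Type*} [TopologicalSpace X] [CompactSpace X]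
    [MeasurableSpace X] [BorelSpace X] (μ : ProbabilityMeasure X) : WeakDual ℝ C(X, ℝ) :=
  have hint : ∀ f : C(X, ℝ), Integrable (fun x => f x) (μ : Measure X) := fun f =>
    (BoundedContinuousFunction.mkOfCompact f).integrable (μ : Measure X)
  StrongDual.toWeakDual <|
    LinearMap.mkContinuous
      { toFun := fun f : C(X, ℝ) => ∫ x, f x ∂(μ : Measure X)
        map_add' := fun f g => integral_add (hint f) (hint g)
        map_smul' := fun c f => integral_const_mul c (fun x => f x) } 1
      (fun f => by
        simpa using norm_integral_le_of_norm_le_const (μ := (μ : Measure X))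
          (Filter.Eventually.of_forall (fun x => f.norm_coe_le_norm x)))

/-- The inclusion `ℳ(X)^k ⊆ (C(X)^*)^k`. -/
noncomputable def measureFunctionalTuple {X : Type*} [TopologicalSpace X] [CompactSpace X]
    [MeasurableSpace X] [BorelSpace X] {k : ℕ} (μ : Fin k → ProbabilityMeasure X) :
    Fin k → WeakDual ℝ C(X, ℝ) :=
  fun j => measureFunctional (μ j)

/-- The inclusion `X^k ⊆ ℳ(X)^k` through Dirac measures. -/
noncomputable def diracTuple {X : Type*} [MeasurableSpace X] {k : ℕ} (x : Fin k → X) :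
    Fin k → ProbabilityMeasure X :=
  fun j => diracProba (x j)

/-- The tuple `(μ^{(1)}, …, μ^{(k)})` of marginals of a probability measure on `X^k`. -/
noncomputable def marginalTuple {X : Type*} [MeasurableSpace X] {k : ℕ}
    (μ : ProbabilityMeasure (Fin k → X)) : Fin k → ProbabilityMeasure X :=
  fun j => μ.map (f := fun x : Fin k → X => x j) (measurable_pi_apply j).aemeasurable

/-- A probability measure on a subset `S`, viewed as a probability measure on the ambient space. -/
noncomputable def extendMeasure {Z : Type*} [MeasurableSpace Z] {S : Set Z}
    (μ : ProbabilityMeasure S) : ProbabilityMeasure Z :=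
  μ.map (f := fun z : S => (z : Z)) measurable_subtype_coe.aemeasurable

/-! The set `IETuples Γ k (ProbabilityMeasure X)` is closed, it contains the Dirac tuples of
IE-tuples of `X` because `x ↦ δ_x` is continuous and equivariant, and it is convex: amenability lets
two independence sets of positive density be intersected after a translation
(`HasPositiveDensity.and`), and on the intersection the realising measures can be mixed. This gives
one inclusion in the closed convex hull statement.

The hard inclusion is `sum_integral_le_of_mem_IETuples`. If an IE-tuple `μ` of measures were outside
the hull, Hahn–Banach would give functions `f j` with `∑ j, f j (x j) < u` on IE-tuples of points
but `∑ j, ∫ f j dμ j > u`. Independence near `μ` on a finite set `J` provides, for each colouring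
`σ` of `J`, a measure and hence, by averaging, a point whose orbit makes the normalised sum of the
values of `f (σ s)` over `s ∈ J` nonnegative. Coding orbits by a finite cover of `X` turns these
points into words. A weighted Sauer–Shelah lemma (`maxWeightSum_le_prod_card_shatteredSets`, used
through `exists_pattern_of_sum_nonneg`) finds a `k`-tuple of cover elements that is independent on a
positive proportion of `J` and whose box meets `{∑ f j ≥ u}`. That closed set contains no IE-tuple,
so a fine cover has only boxes of zero independence density there, a contradiction.

Marginals of measures on `IETuples Γ k X` form a compact convex set, which is again the hull. Its
extreme points are Dirac tuples of IE-tuples by a conditioning argument, while any Dirac tuple it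
contains is extreme; hence the remaining claims. -/

open scoped NNReal

/-! ### A weighted Sauer–Shelah lemma -/

/-- The sum over all `σ : Fin n → κ` of the largest weight `∏ s, w (σ s) (ω s)` of a word `ω ∈ S`. -/
noncomputable def maxWeightSum {κ β : Type*} [Fintype κ] (w : κ → β → ℝ≥0) {n : ℕ}
    (S : Finset (Fin n → β)) : ℝ≥0 :=
  ∑ σ : Fin n → κ, S.sup fun ω => ∏ s, w (σ s) (ω s)

open Classical in
/-- The sets of coordinates on which every pattern `v ∘ τ` is realised by a word in `S`. -/
noncomputable def shatteredSets {κ β : Type*} (v : κ → β) {n : ℕ}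
    (S : Finset (Fin n → β)) : Finset (Finset (Fin n)) :=
  Finset.univ.filter fun W => ∀ τ : Fin n → κ, ∃ ω ∈ S, ∀ s ∈ W, ω s = v (τ s)

open Classical in
/-- The tails of the words in `S` that begin with the letter `a`. -/
noncomputable def wordFiber {β : Type*} [Fintype β] {n : ℕ} (S : Finset (Fin (n + 1) → β)) (a : β) :
    Finset (Fin n → β) :=
  Finset.univ.filter fun ω => (Fin.cons a ω : Fin (n + 1) → β) ∈ S

open Classical in
/-- The tails of all words in `S`. -/
noncomputable def wordTails {β : Type*} {n : ℕ} (S : Finset (Fin (n + 1) → β)) :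
    Finset (Fin n → β) :=
  S.image Fin.tail

section Words

variable {κ β : Type*} {n : ℕ}

lemma mem_shatteredSets {v : κ → β} {S : Finset (Fin n → β)} {W : Finset (Fin n)} :
    W ∈ shatteredSets v S ↔ ∀ τ : Fin n → κ, ∃ ω ∈ S, ∀ s ∈ W, ω s = v (τ s) := by
  classical
  simp [shatteredSets]

lemma shatteredSets_mono {v : κ → β} {S T : Finset (Fin n → β)} (h : S ⊆ T) :
    shatteredSets v S ⊆ shatteredSets v T := by
  intro W hW
  rw [mem_shatteredSets] at hW ⊢
  intro τ
  obtain ⟨ω, hω, h'⟩ := hW τ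
  exact ⟨ω, h hω, h'⟩

lemma mem_wordFiber [Fintype β] {S : Finset (Fin (n + 1) → β)} {a : β} {ω : Fin n → β} :
    ω ∈ wordFiber S a ↔ (Fin.cons a ω : Fin (n + 1) → β) ∈ S := by
  classical
  simp [wordFiber]

lemma wordFiber_subset_wordTails [Fintype β] (S : Finset (Fin (n + 1) → β)) (a : β) :
    wordFiber S a ⊆ wordTails S := by
  classical
  intro ω hω
  rw [mem_wordFiber] at hω
  exact Finset.mem_image.2 ⟨_, hω, by simp⟩

lemma tail_mem_wordFiber [Fintype β] {S : Finset (Fin (n + 1) → β)} {ω : Fin (n + 1) → β} (h : ω ∈ S) :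
    Fin.tail ω ∈ wordFiber S (ω 0) := by
  rw [mem_wordFiber, Fin.cons_self_tail]
  exact h

lemma tail_mem_wordTails {S : Finset (Fin (n + 1) → β)} {ω : Fin (n + 1) → β} (h : ω ∈ S) :
    Fin.tail ω ∈ wordTails S :=
  open Classical in Finset.mem_image_of_mem _ h

lemma map_succ_mem_shatteredSets {v : κ → β} {S : Finset (Fin (n + 1) → β)} {W : Finset (Fin n)}
    (hW : W ∈ shatteredSets v (wordTails S)) :
    W.map (Fin.succEmb n) ∈ shatteredSets v S := by
  classical
  rw [mem_shatteredSets] at hW ⊢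
  intro τ
  obtain ⟨ω', hω', h⟩ := hW (Fin.tail τ)
  obtain ⟨ω, hω, rfl⟩ := Finset.mem_image.1 hω'
  refine ⟨ω, hω, fun s hs => ?_⟩
  obtain ⟨t, ht, rfl⟩ := Finset.mem_map.1 hs
  exact h t ht

lemma insert_zero_mem_shatteredSets [Fintype β] {v : κ → β} {S : Finset (Fin (n + 1) → β)}
    {W : Finset (Fin n)} (hW : ∀ j, W ∈ shatteredSets v (wordFiber S (v j))) :
    insert 0 (W.map (Fin.succEmb n)) ∈ shatteredSets v S := by
  classical
  simp only [mem_shatteredSets] at hW ⊢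
  intro τ
  obtain ⟨ω, hω, h⟩ := hW (τ 0) (Fin.tail τ)
  refine ⟨_, mem_wordFiber.1 hω, fun s hs => ?_⟩
  rcases Finset.mem_insert.1 hs with rfl | hs
  · simp
  · obtain ⟨t, ht, rfl⟩ := Finset.mem_map.1 hs
    simpa [Fin.tail] using h t ht

lemma card_shatteredSets_wordTails_le {v : κ → β} {S : Finset (Fin (n + 1) → β)} :
    (shatteredSets v (wordTails S)).card ≤ (shatteredSets v S).card :=
  Finset.card_le_card_of_injOn (fun W => W.map (Fin.succEmb n))
    (fun _ hW => map_succ_mem_shatteredSets hW)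
    (fun _ _ _ _ h => Finset.map_injective _ h)

lemma card_shatteredSets_fiber_le [Fintype β] {v : κ → β} {S : Finset (Fin (n + 1) → β)} (a : β) :
    (shatteredSets v (wordFiber S a)).card ≤ (shatteredSets v S).card :=
  (Finset.card_le_card (shatteredSets_mono (wordFiber_subset_wordTails S a))).trans
    card_shatteredSets_wordTails_le

/-- If `m` bounds from below the number of sets shattered by each fiber, then the whole family
shatters at least `(1 + 1 / k) m` sets. -/
lemma card_shatteredSets_ge [Fintype β] [Fintype κ] [Nonempty κ] {v : κ → β} {S : Finset (Fin (n + 1) → β)}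
    {m : ℕ} (hm : ∀ j, m ≤ (shatteredSets v (wordFiber S (v j))).card) :
    (Fintype.card κ + 1) * m ≤ Fintype.card κ * (shatteredSets v S).card := by
  classical
  set T : κ → Finset (Finset (Fin n)) := fun j => shatteredSets v (wordFiber S (v j)) with hT
  set U : Finset (Finset (Fin n)) := Finset.univ.biUnion T with hU
  set I : Finset (Finset (Fin n)) := Finset.univ.filter fun W => ∀ j, W ∈ T j with hI
  have hTU : ∀ j, T j ⊆ U := fun j => Finset.subset_biUnion_of_mem T (Finset.mem_univ j)
  have hIU : I ⊆ U := by
    intro W hW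
    obtain ⟨j⟩ := (inferInstance : Nonempty κ)
    exact hTU j ((Finset.mem_filter.1 hW).2 j)
  -- Shifting embeds `U` into the shattered sets avoiding `0`; shifting and adjoining `0` embeds `I`
  -- into those containing `0`.
  have h1 : U.card + I.card ≤ (shatteredSets v S).card := by
    have e1 : (U.image fun W => W.map (Fin.succEmb n)).card = U.card :=
      Finset.card_image_of_injective _ (Finset.map_injective _)
    have h0 : ∀ W : Finset (Fin n), (0 : Fin (n + 1)) ∉ W.map (Fin.succEmb n) := by
      intro W h
      obtain ⟨t, -, ht⟩ := Finset.mem_map.1 h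
      exact Fin.succ_ne_zero t ht
    have e2 : (I.image fun W => insert 0 (W.map (Fin.succEmb n))).card = I.card := by
      refine Finset.card_image_of_injective _ fun W W' h => ?_
      have := congrArg (fun Z => Finset.erase Z 0) h
      simp only [Finset.erase_insert (h0 _)] at this
      exact Finset.map_injective _ this
    rw [← e1, ← e2, ← Finset.card_union_of_disjoint]
    · refine Finset.card_le_card (Finset.union_subset ?_ ?_)
      · intro Z hZ
        obtain ⟨W, hW, rfl⟩ := Finset.mem_image.1 hZ
        obtain ⟨j, -, hj⟩ := Finset.mem_biUnion.1 hW
        exact map_succ_mem_shatteredSets (shatteredSets_mono (wordFiber_subset_wordTails S _) hj)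
      · intro Z hZ
        obtain ⟨W, hW, rfl⟩ := Finset.mem_image.1 hZ
        exact insert_zero_mem_shatteredSets (Finset.mem_filter.1 hW).2
    · rw [Finset.disjoint_left]
      intro Z hZ hZ'
      obtain ⟨W, -, rfl⟩ := Finset.mem_image.1 hZ
      obtain ⟨W', -, h⟩ := Finset.mem_image.1 hZ'
      exact h0 W (h ▸ Finset.mem_insert_self _ _)
  have h2 : m ≤ U.card := by
    obtain ⟨j⟩ := (inferInstance : Nonempty κ)
    exact (hm j).trans (Finset.card_le_card (hTU j))
  -- Double counting: a set in `U` but not in `I` is missed by at least one `T j`, so `∑ j, |T j| ≤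
  -- (k - 1) |U| + |I|` with `k = |κ|`.
  have h3 : Fintype.card κ * m + U.card ≤ Fintype.card κ * U.card + I.card := by
    have e : ∀ j, (T j).card = ∑ W ∈ U, if W ∈ T j then 1 else 0 := by
      intro j
      rw [Finset.sum_boole, Finset.filter_mem_eq_inter, Finset.inter_eq_right.2 (hTU j)]
      simp
    have hk : Fintype.card κ * m ≤ ∑ j, (T j).card := by
      simpa using Finset.card_nsmul_le_sum Finset.univ (fun j => (T j).card) m (fun j _ => hm j)
    have hs : (∑ j, (T j).card) + U.card ≤ Fintype.card κ * U.card + I.card := by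
      have eI : I.card = ∑ W ∈ U, if W ∈ I then 1 else 0 := by
        rw [Finset.sum_boole, Finset.filter_mem_eq_inter, Finset.inter_eq_right.2 hIU]
        simp
      rw [Finset.sum_congr rfl fun j _ => e j, Finset.sum_comm, eI, Finset.card_eq_sum_ones U,
        Finset.mul_sum, ← Finset.sum_add_distrib, ← Finset.sum_add_distrib]
      refine Finset.sum_le_sum fun W _ => ?_
      rw [Finset.sum_boole]
      have hle : (Finset.univ.filter fun j => W ∈ T j).card ≤ Fintype.card κ :=
        Finset.card_le_univ _
      by_cases hW : W ∈ I
      · simpa [hW] using hle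
      · have : (Finset.univ.filter fun j => W ∈ T j).card < Fintype.card κ := by
          obtain ⟨j, hj⟩ := not_forall.1 fun h => hW (Finset.mem_filter.2 ⟨Finset.mem_univ _, h⟩)
          exact Finset.card_lt_univ_of_notMem (x := j) (by simpa using hj)
        simp only [hW, if_false, Nat.cast_id]
        omega
    omega
  nlinarith [Fintype.card_pos (α := κ)]

lemma maxWeightSum_empty [Fintype κ] (w : κ → β → ℝ≥0) :
    maxWeightSum w (∅ : Finset (Fin n → β)) = 0 := by
  simp [maxWeightSum]

/-- Split a family of words by whether the first letter lies in `H`. -/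
lemma maxWeightSum_le [Fintype β] [Fintype κ] (w : κ → β → ℝ≥0) (S : Finset (Fin (n + 1) → β))
    (H : Finset β) [DecidablePred (· ∈ H)] :
    maxWeightSum w S ≤ (∑ j, H.sup (w j)) * maxWeightSum w (wordTails S) +
      ∑ a, if a ∈ H then 0 else (∑ j, w j a) * maxWeightSum w (wordFiber S a) := by
  classical
  have key : ∀ (j : κ) (σ : Fin n → κ),
      (S.sup fun ω => ∏ s, w ((Fin.cons j σ : Fin (n + 1) → κ) s) (ω s)) ≤
        H.sup (w j) * ((wordTails S).sup fun ω => ∏ s, w (σ s) (ω s)) +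
          ∑ a, if a ∈ H then 0 else
            w j a * ((wordFiber S a).sup fun ω => ∏ s, w (σ s) (ω s)) := by
    intro j σ
    refine Finset.sup_le fun ω hω => ?_
    rw [Fin.prod_univ_succ]
    simp only [Fin.cons_zero, Fin.cons_succ]
    by_cases h : ω 0 ∈ H
    · refine le_add_of_le_of_nonneg (mul_le_mul' (Finset.le_sup (f := w j) h) ?_) (zero_le)
      exact Finset.le_sup (f := fun ω : Fin n → β => ∏ s, w (σ s) (ω s)) (tail_mem_wordTails hω)
    · refine le_add_of_nonneg_of_le (zero_le) ?_
      refine le_trans ?_ (Finset.single_le_sum (fun _ _ => zero_le) (Finset.mem_univ (ω 0)))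
      rw [if_neg h]
      exact mul_le_mul' le_rfl (Finset.le_sup (f := fun ω : Fin n → β => ∏ s, w (σ s) (ω s))
        (tail_mem_wordFiber hω))
  have e : maxWeightSum w S = ∑ j, ∑ σ : Fin n → κ,
      S.sup fun ω => ∏ s, w ((Fin.cons j σ : Fin (n + 1) → κ) s) (ω s) := by
    rw [maxWeightSum, ← (Fin.consEquiv fun _ : Fin (n + 1) => κ).sum_comp, Fintype.sum_prod_type]
    rfl
  rw [e]
  refine (Finset.sum_le_sum fun j _ => Finset.sum_le_sum fun σ _ => key j σ).trans ?_
  simp only [Finset.sum_add_distrib, ← Finset.mul_sum]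
  rw [Finset.sum_mul]
  refine add_le_add le_rfl (le_of_eq ?_)
  simp only [maxWeightSum]
  rw [Finset.sum_congr rfl fun j _ => Finset.sum_comm, Finset.sum_comm]
  refine Finset.sum_congr rfl fun a _ => ?_
  by_cases h : a ∈ H
  · simp [h]
  · simp only [h, if_false, ← Finset.mul_sum, Finset.sum_mul]

/-- Absorption: the hypothesis `hR` says `ρ ≤ (1 - c) R`, and `h` says `(1 - c) M ≤ ρ Q`. -/
lemma NNReal.le_mul_of_le_mul_add_mul {M Q ρ R c : ℝ≥0} (h : M ≤ ρ * Q + c * M)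
    (hR : ρ + R * c ≤ R) (hc : c < 1) : M ≤ R * Q := by
  have h' : (M : ℝ) ≤ ρ * Q + c * M := by exact_mod_cast h
  have hR' : (ρ : ℝ) + R * c ≤ R := by exact_mod_cast hR
  have hc' : (0 : ℝ) < 1 - c := by
    have : (c : ℝ) < 1 := by exact_mod_cast hc
    linarith
  have h2 := mul_le_mul_of_nonneg_right hR' Q.coe_nonneg
  have h3 : (1 - c : ℝ) * M ≤ (1 - c) * (R * Q) := by linarith
  exact_mod_cast le_of_mul_le_mul_left h3 hc'

/-- A weighted Sauer–Shelah lemma: if every alphabet containing no pattern of `G` has total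
weight at most `ρ`, then the weight of a family of words exceeds `R ^ n` only by virtue of the
number of sets on which it realises patterns of `G`. -/
lemma maxWeightSum_le_prod_card_shatteredSets [Fintype β] [Fintype κ] [Nonempty κ]
    (w : κ → β → ℝ≥0) (G : Finset (κ → β)) {ρ R γ : ℝ≥0} {A : ℕ}
    (hG : ∀ H : Finset β, (∀ v ∈ G, ∃ j, v j ∉ H) → ∑ j, H.sup (w j) ≤ ρ)
    (hR : ρ + R * ((∑ a, ∑ j, w j a) * γ) ≤ R) (hγ : (∑ a, ∑ j, w j a) * γ < 1) (hγ0 : 0 < γ)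
    (hA : 1 ≤ γ * R * (1 + 1 / (Fintype.card κ : ℝ≥0)) ^ A) (S : Finset (Fin n → β)) :
    maxWeightSum w S ≤ R ^ n * ∏ v ∈ G, ((shatteredSets v S).card : ℝ≥0) ^ A := by
  classical
  induction n with
  | zero =>
    rcases S.eq_empty_or_nonempty with rfl | ⟨ω, hω⟩
    · rw [maxWeightSum_empty]
      exact zero_le
    · have h1 : maxWeightSum w S ≤ 1 := by
        simp only [maxWeightSum, Finset.univ_unique, Finset.sum_singleton]
        exact Finset.sup_le fun ω _ => by simp
      have h2 : ∀ v ∈ G, (1 : ℝ≥0) ≤ ((shatteredSets v S).card : ℝ≥0) ^ A := by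
        intro v _
        have : (∅ : Finset (Fin 0)) ∈ shatteredSets v S :=
          mem_shatteredSets.2 fun τ => ⟨ω, hω, by simp⟩
        exact one_le_pow₀ (by exact_mod_cast Finset.card_pos.2 ⟨_, this⟩)
      rw [pow_zero, one_mul]
      exact h1.trans (Finset.one_le_prod' h2)
  | succ n ih =>
    set P : Finset (Fin (n + 1) → β) → ℝ≥0 := fun S =>
      ∏ v ∈ G, ((shatteredSets v S).card : ℝ≥0) ^ A with hP
    set C : ℝ≥0 := ∑ a, ∑ j, w j a with hC
    -- The heavy letters, whose fiber retains a fraction `γ` of the weight. If they contain no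
    -- pattern of `G`, the growth rate `ρ` applies to them and the light letters are absorbed.
    set H : Finset β := Finset.univ.filter fun a =>
      γ * maxWeightSum w S ≤ maxWeightSum w (wordFiber S a) with hH
    by_cases hgood : ∀ v ∈ G, ∃ j, v j ∉ H
    · have h1 := maxWeightSum_le w S H
      have h2 : (∑ a, if a ∈ H then 0 else (∑ j, w j a) * maxWeightSum w (wordFiber S a)) ≤
          C * γ * maxWeightSum w S := by
        rw [hC, Finset.sum_mul, Finset.sum_mul]
        refine Finset.sum_le_sum fun a _ => ?_
        split_ifs with h
        · exact zero_le
        · rw [mul_assoc]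
          refine mul_le_mul' le_rfl (le_of_not_ge fun h' => h ?_)
          simpa [hH] using h'
      have h3 : maxWeightSum w (wordTails S) ≤ R ^ n * P S := by
        refine (ih (wordTails S)).trans (mul_le_mul' le_rfl (Finset.prod_le_prod' fun v _ => ?_))
        exact pow_le_pow_left' (by exact_mod_cast card_shatteredSets_wordTails_le) A
      have h4 : maxWeightSum w S ≤ ρ * (R ^ n * P S) + C * γ * maxWeightSum w S :=
        h1.trans (add_le_add (mul_le_mul' (hG H hgood) h3) h2)
      rw [pow_succ', mul_assoc]
      exact NNReal.le_mul_of_le_mul_add_mul h4 hR hγ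
    -- Some pattern `v ∈ G` has only heavy letters. Passing to one of its fibers costs a factor `γ`
    -- in weight, but the shattered sets of `S` outnumber those of the poorest fiber by a factor `1
    -- + 1 / k`; its `A`-th power pays for `γ * R`.
    · push Not at hgood
      obtain ⟨v, hv, hvH⟩ := hgood
      obtain ⟨j, -, hj⟩ := Finset.exists_min_image Finset.univ
        (fun j => (shatteredSets v (wordFiber S (v j))).card) Finset.univ_nonempty
      have h1 : γ * maxWeightSum w S ≤ maxWeightSum w (wordFiber S (v j)) := by
        simpa [hH] using hvH j
      have h2 := card_shatteredSets_ge fun i => hj i (Finset.mem_univ i)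
      have hk : (0 : ℝ≥0) < Fintype.card κ := by exact_mod_cast Fintype.card_pos
      set q : ℝ≥0 := 1 + 1 / (Fintype.card κ : ℝ≥0) with hq
      have h3 : q * ((shatteredSets v (wordFiber S (v j))).card : ℝ≥0) ≤
          (shatteredSets v S).card := by
        refine le_of_mul_le_mul_left ?_ hk
        calc (Fintype.card κ : ℝ≥0) * (q * ((shatteredSets v (wordFiber S (v j))).card : ℝ≥0))
            = (Fintype.card κ + 1) * ((shatteredSets v (wordFiber S (v j))).card : ℝ≥0) := by
              rw [hq]; field_simp
          _ ≤ _ := by exact_mod_cast h2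
      have h4 : q ^ A * maxWeightSum w (wordFiber S (v j)) ≤ R ^ n * P S := by
        calc q ^ A * maxWeightSum w (wordFiber S (v j))
            ≤ q ^ A * (R ^ n * ∏ u ∈ G,
                ((shatteredSets u (wordFiber S (v j))).card : ℝ≥0) ^ A) :=
              mul_le_mul' le_rfl (ih _)
          _ = R ^ n * ((q * ((shatteredSets v (wordFiber S (v j))).card : ℝ≥0)) ^ A *
                ∏ u ∈ G.erase v, ((shatteredSets u (wordFiber S (v j))).card : ℝ≥0) ^ A) := by
              rw [← Finset.mul_prod_erase G _ hv, mul_pow]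
              ring
          _ ≤ R ^ n * (((shatteredSets v S).card : ℝ≥0) ^ A *
                ∏ u ∈ G.erase v, ((shatteredSets u S).card : ℝ≥0) ^ A) := by
              refine mul_le_mul' le_rfl (mul_le_mul' (pow_le_pow_left' h3 A)
                (Finset.prod_le_prod' fun u _ => pow_le_pow_left' ?_ A))
              exact_mod_cast card_shatteredSets_fiber_le _
          _ = R ^ n * P S := congrArg (R ^ n * ·) (Finset.mul_prod_erase G
                (fun u => ((shatteredSets u S).card : ℝ≥0) ^ A) hv)
      refine le_of_mul_le_mul_left (a := γ) ?_ hγ0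
      calc γ * maxWeightSum w S ≤ 1 * maxWeightSum w (wordFiber S (v j)) := by rwa [one_mul]
        _ ≤ γ * R * q ^ A * maxWeightSum w (wordFiber S (v j)) := mul_le_mul' hA le_rfl
        _ = γ * R * (q ^ A * maxWeightSum w (wordFiber S (v j))) := by ring
        _ ≤ γ * R * (R ^ n * P S) := mul_le_mul' le_rfl h4
        _ = γ * (R ^ (n + 1) * P S) := by ring

end Words

/-! ### From counting shattered sets to a free pattern of positive proportion -/

/-- A family of subsets of `Fin n` of small relative size has small exponential growth rate. -/
lemma exists_card_le_pow_of_card_le {q : ℝ} (hq : 1 < q) :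
    ∃ c : ℝ, 0 < c ∧ ∀ (n : ℕ) (F : Finset (Finset (Fin n))),
      (∀ W ∈ F, (W.card : ℝ) ≤ c * n) → (F.card : ℝ) ≤ q ^ n := by
  -- Weigh `W` by `x ^ |W|`: each member of the family weighs at least `r⁻¹ ^ n`, while all subsets
  -- together weigh `(1 + x) ^ n ≤ r ^ n`. Hence there are at most `r ^ (2 * n) = q ^ n` members.
  set r : ℝ := √q with hr
  have hr1 : 1 < r := by rw [hr]; exact Real.lt_sqrt_of_sq_lt (by simpa using hq)
  have hrr : r * r = q := Real.mul_self_sqrt (by linarith)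
  obtain ⟨x, hx0, hx⟩ := exists_between (show (0 : ℝ) < min (r - 1) 1 by
    exact lt_min (by linarith) one_pos)
  have hx1 : x < 1 := hx.trans_le (min_le_right _ _)
  have hxr : x < r - 1 := hx.trans_le (min_le_left _ _)
  have hlog : Real.log x < 0 := Real.log_neg hx0 hx1
  have hlr : 0 < Real.log r := Real.log_pos hr1
  refine ⟨Real.log r / -Real.log x, div_pos hlr (by linarith), fun n F hF => ?_⟩
  set c : ℝ := Real.log r / -Real.log x with hc
  have hxc : x ^ c = r⁻¹ := by
    rw [Real.rpow_def_of_pos hx0, hc, ← Real.exp_log (show 0 < r by linarith), ← Real.exp_neg,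
      Real.log_exp]
    congr 1
    have hlog' := hlog.ne
    field_simp
  have h1 : ∀ W ∈ F, (r⁻¹) ^ n ≤ x ^ W.card := by
    intro W hW
    rw [← hxc, ← Real.rpow_natCast, ← Real.rpow_mul hx0.le, ← Real.rpow_natCast]
    exact Real.rpow_le_rpow_of_exponent_ge hx0 hx1.le (hF W hW)
  have h2 : (F.card : ℝ) * (r⁻¹) ^ n ≤ r ^ n := by
    calc (F.card : ℝ) * (r⁻¹) ^ n = ∑ _W ∈ F, (r⁻¹) ^ n := by simp
      _ ≤ ∑ W ∈ F, x ^ W.card := Finset.sum_le_sum h1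
      _ ≤ ∑ W : Finset (Fin n), x ^ W.card :=
        Finset.sum_le_sum_of_subset_of_nonneg (Finset.subset_univ F) fun _ _ _ => by positivity
      _ = (x + 1) ^ n := by
        have := Fintype.sum_pow_mul_eq_add_pow (Fin n) x 1
        simpa using this
      _ ≤ r ^ n := pow_le_pow_left₀ (by linarith) (by linarith) n
  have hrn : (0 : ℝ) < r ^ n := by positivity
  calc (F.card : ℝ) = (F.card : ℝ) * (r⁻¹) ^ n * r ^ n := by
        rw [mul_assoc, ← mul_pow, inv_mul_cancel₀ (by linarith), one_pow, mul_one]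
    _ ≤ r ^ n * r ^ n := mul_le_mul_of_nonneg_right h2 hrn.le
    _ = q ^ n := by rw [← mul_pow, hrr]

/-- If every shattered set were small, there would be few of them, and the weighted Sauer–Shelah
bound with a rate `R'` strictly between `ρ` and `R` would keep the total weight below `R ^ n`. -/
lemma exists_large_shatteredSet {κ β : Type*} [Fintype β] [Fintype κ] [Nonempty κ]
    (w : κ → β → ℝ≥0) (G : Finset (κ → β)) {ρ R : ℝ≥0} (hρ : ρ < R)
    (hG : ∀ H : Finset β, (∀ v ∈ G, ∃ j, v j ∉ H) → ∑ j, H.sup (w j) ≤ ρ) :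
    ∃ c : ℝ, 0 < c ∧ ∀ (n : ℕ) (S : Finset (Fin n → β)), n ≠ 0 → R ^ n ≤ maxWeightSum w S →
      ∃ v ∈ G, ∃ W ∈ shatteredSets v S, c * n ≤ W.card := by
  obtain ⟨R', hρ', hR'⟩ := exists_between hρ
  have hR'0 : 0 < R' := pos_of_gt hρ'
  set C : ℝ≥0 := ∑ a, ∑ j, w j a with hC
  -- Chosen so that `R' * (C * γ) = (R' - ρ) * (C / (C + 1))`, which leaves room in both smallness
  -- conditions.
  set γ : ℝ≥0 := (R' - ρ) / (R' * (C + 1)) with hγ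
  have hsub : 0 < R' - ρ := tsub_pos_of_lt hρ'
  have hγ0 : 0 < γ := div_pos hsub (mul_pos hR'0 (by positivity))
  have hfrac : C / (C + 1) < 1 := (div_lt_one (by positivity)).2 (lt_add_one C)
  have e1 : R' * (C * γ) = (R' - ρ) * (C / (C + 1)) := by
    rw [hγ]; field_simp
  have h1 : ρ + R' * (C * γ) ≤ R' := by
    rw [e1]
    calc ρ + (R' - ρ) * (C / (C + 1)) ≤ ρ + (R' - ρ) * 1 :=
          add_le_add le_rfl (mul_le_mul' le_rfl hfrac.le)
      _ = R' := by rw [mul_one, add_tsub_cancel_of_le hρ'.le]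
  have h2 : C * γ < 1 := by
    have h : R' * (C * γ) < R' * 1 := by
      rw [e1, mul_one]
      calc (R' - ρ) * (C / (C + 1)) < (R' - ρ) * 1 := mul_lt_mul_of_pos_left hfrac hsub
        _ ≤ R' := by rw [mul_one]; exact tsub_le_self
    exact lt_of_mul_lt_mul_left h hR'0.le
  have hk : (0 : ℝ≥0) < Fintype.card κ := by exact_mod_cast Fintype.card_pos
  obtain ⟨A, hA⟩ := pow_unbounded_of_one_lt (1 / (γ * R'))
    (show 1 < 1 + 1 / (Fintype.card κ : ℝ≥0) from lt_add_of_pos_right 1 (by positivity))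
  have hA' : 1 ≤ γ * R' * (1 + 1 / (Fintype.card κ : ℝ≥0)) ^ A := by
    have h := mul_le_mul' (le_refl (γ * R')) hA.le
    rwa [mul_one_div_cancel (by positivity)] at h
  -- The extra `1` makes `q ^ (A * G.card) < q ^ N = R / R'` strict.
  set N : ℕ := A * G.card + 1 with hN
  set t : ℝ := R / R' with ht
  have ht1 : 1 < t := (one_lt_div (by exact_mod_cast hR'0)).2 (by exact_mod_cast hR')
  set q : ℝ := t ^ ((N : ℝ)⁻¹) with hq
  have hq1 : 1 < q := Real.one_lt_rpow ht1 (by positivity)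
  have hqN : q ^ N = t := Real.rpow_inv_natCast_pow (by linarith) (by omega)
  obtain ⟨c, hc, hcard⟩ := exists_card_le_pow_of_card_le hq1
  refine ⟨c, hc, fun n S hn hS => ?_⟩
  by_contra! hcon
  have hb := maxWeightSum_le_prod_card_shatteredSets w G hG h1 h2 hγ0 hA' S
  have h3 : (R : ℝ) ^ n ≤ R' ^ n * ∏ v ∈ G, ((shatteredSets v S).card : ℝ) ^ A := by
    exact_mod_cast hS.trans hb
  have h4 : ∏ v ∈ G, ((shatteredSets v S).card : ℝ) ^ A ≤ (q ^ (A * G.card)) ^ n := by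
    calc ∏ v ∈ G, ((shatteredSets v S).card : ℝ) ^ A ≤ ∏ _v ∈ G, (q ^ n) ^ A := by
          refine Finset.prod_le_prod (fun _ _ => by positivity) fun v hv => ?_
          exact pow_le_pow_left₀ (by positivity)
            (hcard n _ fun W hW => (hcon v hv W hW).le) A
      _ = (q ^ (A * G.card)) ^ n := by
          rw [Finset.prod_const, ← pow_mul, ← pow_mul, ← pow_mul]
          congr 1
          ring
  have h5 : q ^ (A * G.card) < t := by
    rw [← hqN]
    exact pow_lt_pow_right₀ hq1 (by omega)
  have h6 : (q ^ (A * G.card)) ^ n < t ^ n := pow_lt_pow_left₀ h5 (by positivity) hn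
  have hR'n : (0 : ℝ) < (R' : ℝ) ^ n := pow_pos (by exact_mod_cast hR'0) n
  have h7 : (R : ℝ) ^ n = R' ^ n * t ^ n := by
    rw [← mul_pow, ht, mul_div_cancel₀]
    exact_mod_cast hR'0.ne'
  have h8 := mul_lt_mul_of_pos_left (h4.trans_lt h6) hR'n
  linarith

/-- If `f` has nonnegative sum along a word `ω σ` for every colouring `σ`, then a pattern `v` on
which `f` is not too negative is realised freely on a set of coordinates of positive proportion. -/
lemma exists_pattern_of_sum_nonneg {κ β : Type*} [Fintype β] [Fintype κ] [Nonempty κ]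
    (f : κ → β → ℝ) (G : Finset (κ → β)) {η : ℝ} (hη : 0 < η)
    (hG : ∀ v : κ → β, v ∉ G → ∑ j, f j (v j) ≤ -η) :
    ∃ c : ℝ, 0 < c ∧ ∀ (ι : Type*) [Fintype ι] [Nonempty ι] (ω : (ι → κ) → ι → β),
      (∀ σ, 0 ≤ ∑ s, f (σ s) (ω σ s)) →
      ∃ v ∈ G, ∃ W : Finset ι, c * Fintype.card ι ≤ W.card ∧
        ∀ τ : ι → κ, ∃ σ, ∀ s ∈ W, ω σ s = v (τ s) := by
  classical
  set M : ℝ := 1 + ∑ j, ∑ a, |f j a| with hM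
  have hM1 : 1 ≤ M := le_add_of_nonneg_right (by positivity)
  have hfM : ∀ j a, |f j a| ≤ M := by
    intro j a
    have h1 : |f j a| ≤ ∑ a, |f j a| :=
      Finset.single_le_sum (f := fun a => |f j a|) (fun _ _ => abs_nonneg _) (Finset.mem_univ a)
    have h2 : ∑ a, |f j a| ≤ ∑ j, ∑ a, |f j a| :=
      Finset.single_le_sum (f := fun j => ∑ a, |f j a|) (fun _ _ => by positivity)
        (Finset.mem_univ j)
    linarith
  set k : ℝ := ((Fintype.card κ : ℕ) : ℝ) with hk
  have hk0 : 0 < k := by rw [hk]; exact_mod_cast Fintype.card_pos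
  -- Small enough that `l * M ≤ 1`, so `exp y ≤ 1 + y + y ^ 2` applies to `y = l * f j a`, and that
  -- the quadratic error `k * l ^ 2 * M ^ 2` is at most half of the gain `l * η`.
  set l : ℝ := η / (η * M + 2 * k * M ^ 2) with hl
  have hden : 0 < η * M + 2 * k * M ^ 2 := by positivity
  have hl0 : 0 < l := div_pos hη hden
  have hlden : l * (η * M + 2 * k * M ^ 2) = η := div_mul_cancel₀ _ hden.ne'
  have hlM : l * M ≤ 1 := by
    have : η * (l * M) ≤ η * 1 := by
      have : 0 ≤ l * (2 * k * M ^ 2) := by positivity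
      linarith
    exact le_of_mul_le_mul_left this hη
  have hlk : 2 * (k * (l * M ^ 2)) ≤ η := by
    have : 0 ≤ l * (η * M) := by positivity
    linarith
  set w : κ → β → ℝ≥0 := fun j a => (Real.exp (l * f j a)).toNNReal with hw
  have hwc : ∀ j a, (w j a : ℝ) = Real.exp (l * f j a) := fun j a =>
    Real.coe_toNNReal _ (Real.exp_pos _).le
  have hexp : ∀ j a, (w j a : ℝ) ≤ 1 + l * f j a + l ^ 2 * M ^ 2 := by
    intro j a
    rw [hwc]
    have h1 : |l * f j a| ≤ l * M := by
      rw [abs_mul, abs_of_pos hl0]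
      exact mul_le_mul_of_nonneg_left (hfM j a) hl0.le
    have h2 := (abs_le.1 (Real.abs_exp_sub_one_sub_id_le (h1.trans hlM))).2
    have h3 : (l * f j a) ^ 2 ≤ (l * M) ^ 2 := sq_le_sq' (abs_le.1 h1).1 (abs_le.1 h1).2
    nlinarith
  obtain ⟨c, hc, hmain⟩ := exists_large_shatteredSet w G (ρ := (k - l * η / 2).toNNReal)
    (R := (Fintype.card κ : ℝ≥0)) (by
      rw [← NNReal.coe_lt_coe, NNReal.coe_natCast, Real.coe_toNNReal', max_lt_iff]
      exact ⟨by have := mul_pos hl0 hη; linarith, hk0⟩) (by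
      intro H hH
      rcases H.eq_empty_or_nonempty with rfl | hne
      · simp
      · have hmax : ∀ j, ∃ a ∈ H, H.sup (w j) = w j a := fun j =>
          Finset.exists_mem_eq_sup H hne (w j)
        choose v hv hvw using hmax
        -- The maximising letters form a tuple inside `H`, which contains no pattern of `G`; hence
        -- `hG` bounds the sum along `v`.
        have hvG : v ∉ G := fun h => by
          obtain ⟨j, hj⟩ := hH v h
          exact hj (hv j)
        refine NNReal.le_toNNReal_of_coe_le ?_
        push_cast
        calc ∑ j, ((H.sup (w j) : ℝ≥0) : ℝ) ≤ ∑ j, (1 + l * f j (v j) + l ^ 2 * M ^ 2) :=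
              Finset.sum_le_sum fun j _ => by rw [hvw j]; exact hexp j (v j)
          _ = k + l * ∑ j, f j (v j) + k * (l ^ 2 * M ^ 2) := by
              simp [Finset.sum_add_distrib, Finset.mul_sum, hk]
          _ ≤ k - l * η / 2 := by
              have h1 := mul_le_mul_of_nonneg_left (hG v hvG) hl0.le
              have h2 := mul_le_mul_of_nonneg_left hlk hl0.le
              nlinarith)
  refine ⟨c, hc, fun ι _ _ ω hω => ?_⟩
  set e : ι ≃ Fin (Fintype.card ι) := Fintype.equivFin ι with he
  set S : Finset (Fin (Fintype.card ι) → β) := Finset.univ.image fun σ => ω σ ∘ e.symm with hS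
  -- Each colouring has its own word of weight `exp (l * ∑ s, f (σ s) (ω σ s)) ≥ 1`, so every one of
  -- the `k ^ n` summands is at least `1`.
  have hSw : (Fintype.card κ : ℝ≥0) ^ Fintype.card ι ≤ maxWeightSum w S := by
    have h1 : ∀ σ : Fin (Fintype.card ι) → κ, 1 ≤ S.sup fun ω => ∏ s, w (σ s) (ω s) := by
      intro σ
      have hmem : ω (σ ∘ e) ∘ e.symm ∈ S := Finset.mem_image_of_mem _ (Finset.mem_univ _)
      refine le_trans ?_ (Finset.le_sup (f := fun ω : Fin (Fintype.card ι) → β =>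
        ∏ s, w (σ s) (ω s)) hmem)
      rw [← NNReal.coe_le_coe, NNReal.coe_prod]
      simp only [hwc, Function.comp, ← Real.exp_sum, ← Finset.mul_sum, NNReal.coe_one]
      refine Real.one_le_exp (mul_nonneg hl0.le ?_)
      have h := hω (σ ∘ e)
      rw [← e.symm.sum_comp] at h
      simpa [Function.comp_def] using h
    calc (Fintype.card κ : ℝ≥0) ^ Fintype.card ι
        = ∑ _σ : Fin (Fintype.card ι) → κ, (1 : ℝ≥0) := by simp
      _ ≤ _ := Finset.sum_le_sum fun σ _ => h1 σ
  obtain ⟨v, hv, W, hW, hcW⟩ := hmain _ S Fintype.card_ne_zero hSw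
  refine ⟨v, hv, W.map e.symm.toEmbedding, by simpa using hcW, fun τ => ?_⟩
  obtain ⟨u, hu, huW⟩ := mem_shatteredSets.1 hW (τ ∘ e.symm)
  obtain ⟨σ, -, rfl⟩ := Finset.mem_image.1 hu
  refine ⟨σ, fun s hs => ?_⟩
  obtain ⟨i, hi, rfl⟩ := Finset.mem_map.1 hs
  exact huW i hi

/-! ### Positive density in amenable groups -/

/-- Every nonempty finite subset of `Γ` contains a set with property `P` of proportion bounded
below. -/
def HasPositiveDensity {Γ : Type*} (P : Finset Γ → Prop) : Prop :=
  ∃ c : ℝ, 0 < c ∧ ∀ F : Finset Γ, F.Nonempty → ∃ J ⊆ F, P J ∧ c * F.card ≤ J.card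

section Density

variable {Γ : Type*}

lemma HasPositiveDensity.mono {P Q : Finset Γ → Prop} (h : HasPositiveDensity P)
    (hPQ : ∀ J, P J → Q J) : HasPositiveDensity Q := by
  obtain ⟨c, hc, h⟩ := h
  refine ⟨c, hc, fun F hF => ?_⟩
  obtain ⟨J, hJ, hP, hcard⟩ := h F hF
  exact ⟨J, hJ, hPQ J hP, hcard⟩

variable [Group Γ]

section

variable [DecidableEq Γ]

lemma IsAmenableGroup.exists_card_inv_mul_le (hΓ : IsAmenableGroup Γ) {F : Finset Γ}
    (hF : F.Nonempty) : ∃ E : Finset Γ, E.Nonempty ∧ ((F⁻¹ * E).card : ℝ) ≤ 2 * E.card := by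
  obtain ⟨E, hE, h⟩ := hΓ F⁻¹ hF.inv 1 one_pos
  refine ⟨E, hE, ?_⟩
  have h1 : (F⁻¹ * E).card ≤ ((F⁻¹ * E) ∆ E).card + E.card := by
    refine (Finset.card_le_card fun x hx => ?_).trans (Finset.card_union_le _ _)
    by_cases hxE : x ∈ E
    · exact Finset.mem_union_right _ hxE
    · exact Finset.mem_union_left _ (Finset.mem_symmDiff.2 (Or.inl ⟨hx, hxE⟩))
  have h2 : ((F⁻¹ * E).card : ℝ) ≤ ((F⁻¹ * E) ∆ E).card + E.card := by exact_mod_cast h1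
  have h3 : (((F⁻¹ * E) ∆ E).card : ℝ) < 1 * E.card := by convert h
  linarith

/-- Averaging over translates. -/
lemma exists_card_mul_card_le_card_inter_translate {B J : Finset Γ} (hB : B.Nonempty)
    (hJ : J.Nonempty) :
    ∃ g : Γ, J.card * B.card ≤ (J ∩ B.image (· * g)).card * (B⁻¹ * J).card := by
  obtain ⟨g, -, hg⟩ := Finset.exists_max_image (B⁻¹ * J) (fun g => (J ∩ B.image (· * g)).card)
    (hB.inv.mul hJ)
  refine ⟨g, ?_⟩
  -- Sort the pairs `(b, j)` by `b⁻¹ * j`: the class of `h` injects into `J ∩ B h` through its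
  -- second coordinate.
  have hmaps : ∀ p ∈ B ×ˢ J, p.1⁻¹ * p.2 ∈ B⁻¹ * J := fun p hp =>
    Finset.mul_mem_mul (Finset.inv_mem_inv (Finset.mem_product.1 hp).1) (Finset.mem_product.1 hp).2
  have hfib : ∀ h : Γ, ((B ×ˢ J).filter fun p => p.1⁻¹ * p.2 = h).card ≤
      (J ∩ B.image (· * h)).card := by
    intro h
    refine Finset.card_le_card_of_injOn Prod.snd ?_ ?_
    · intro p hp
      simp only [Finset.coe_filter, Finset.mem_product, Set.mem_ofPred_eq] at hp
      obtain ⟨⟨h1, h2⟩, rfl⟩ := hp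
      exact Finset.mem_coe.2 (Finset.mem_inter.2 ⟨h2, Finset.mem_image.2 ⟨p.1, h1, by simp⟩⟩)
    · intro p hp p' hp' he
      simp only [Finset.coe_filter, Set.mem_ofPred_eq] at hp hp'
      have : p.1⁻¹ * p.2 = p'.1⁻¹ * p'.2 := hp.2.trans hp'.2.symm
      rw [he] at this
      exact Prod.ext (inv_injective (mul_right_cancel this)) he
  calc J.card * B.card = (B ×ˢ J).card := by rw [Finset.card_product, mul_comm]
    _ = ∑ h ∈ B⁻¹ * J, ((B ×ˢ J).filter fun p => p.1⁻¹ * p.2 = h).card :=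
      Finset.card_eq_sum_card_fiberwise hmaps
    _ ≤ ∑ _h ∈ B⁻¹ * J, (J ∩ B.image (· * g)).card :=
      Finset.sum_le_sum fun h hh => (hfib h).trans (hg h hh)
    _ = _ := by rw [Finset.sum_const, smul_eq_mul, mul_comm]

/-- Take `I ⊆ F` for `P` and `J ⊆ E` for `Q`, with `E` almost invariant under `F⁻¹`. An average
translate of `J` meets `I` in at least `|I| |J| / |J⁻¹ I|` points, and `|J⁻¹ I| = |I⁻¹ J| ≤ 2 |E|`.
-/
lemma HasPositiveDensity.and (hΓ : IsAmenableGroup Γ) {P Q : Finset Γ → Prop}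
    (hP : HasPositiveDensity P) (hQ : HasPositiveDensity Q)
    (hPm : ∀ ⦃I J : Finset Γ⦄, I ⊆ J → P J → P I) (hQm : ∀ ⦃I J : Finset Γ⦄, I ⊆ J → Q J → Q I)
    (hQt : ∀ J g, Q J → Q (J.image (· * g))) :
    HasPositiveDensity fun J => P J ∧ Q J := by
  obtain ⟨a, ha, hP⟩ := hP
  obtain ⟨b, hb, hQ⟩ := hQ
  refine ⟨a * b / 2, by positivity, fun F hF => ?_⟩
  obtain ⟨E, hE, hcard⟩ := hΓ.exists_card_inv_mul_le hF
  obtain ⟨I, hIF, hPI, hI⟩ := hP F hF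
  obtain ⟨J, hJE, hQJ, hJ⟩ := hQ E hE
  have hF0 : (0 : ℝ) < F.card := by exact_mod_cast hF.card_pos
  have hE0 : (0 : ℝ) < E.card := by exact_mod_cast hE.card_pos
  have hI0 : I.Nonempty := by
    rw [← Finset.card_pos]
    exact_mod_cast (mul_pos ha hF0).trans_le hI
  have hJ0 : J.Nonempty := by
    rw [← Finset.card_pos]
    exact_mod_cast (mul_pos hb hE0).trans_le hJ
  obtain ⟨g, hg⟩ := exists_card_mul_card_le_card_inter_translate hJ0 hI0
  refine ⟨I ∩ J.image (· * g), Finset.inter_subset_left.trans hIF,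
    ⟨hPm Finset.inter_subset_left hPI, hQm Finset.inter_subset_right (hQt J g hQJ)⟩, ?_⟩
  have h1 : ((J⁻¹ * I).card : ℝ) ≤ 2 * E.card := by
    refine le_trans ?_ hcard
    have e : (J⁻¹ * I).card = (I⁻¹ * J).card := by
      rw [← Finset.card_inv, mul_inv_rev, inv_inv]
    rw [e]
    exact_mod_cast Finset.card_le_card
      (Finset.mul_subset_mul (Finset.inv_subset_inv hIF) hJE)
  have h2 : (I.card : ℝ) * J.card ≤ (I ∩ J.image (· * g)).card * (J⁻¹ * I).card := by
    exact_mod_cast hg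
  have h3 : (a * F.card) * (b * E.card) ≤ (I.card : ℝ) * J.card :=
    mul_le_mul hI hJ (by positivity) (by positivity)
  have h4 := mul_le_mul_of_nonneg_left h1 (Nat.cast_nonneg (α := ℝ) (I ∩ J.image (· * g)).card)
  refine le_of_mul_le_mul_right ?_ hE0
  linarith

/-- Finitely many properties without positive density are simultaneously sparse on a suitable
finite set. -/
lemma exists_forall_card_le_of_not_hasPositiveDensity (hΓ : IsAmenableGroup Γ) {ι : Type*}
    (s : Finset ι) {P : ι → Finset Γ → Prop} (hP : ∀ i ∈ s, ¬ HasPositiveDensity (P i))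
    (hPm : ∀ i, ∀ ⦃I J : Finset Γ⦄, I ⊆ J → P i J → P i I)
    (hPt : ∀ i J g, P i J → P i (J.image (· * g))) {c : ℝ} (hc : 0 < c) :
    ∃ E : Finset Γ, E.Nonempty ∧ ∀ i ∈ s, ∀ J ⊆ E, P i J → (J.card : ℝ) ≤ c * E.card := by
  classical
  have hF : ∀ i, ∃ F : Finset Γ, i ∈ s → F.Nonempty ∧
      ∀ J ⊆ F, P i J → (J.card : ℝ) ≤ c / 2 * F.card := by
    intro i
    by_cases hi : i ∈ s
    · have := hP i hi
      unfold HasPositiveDensity at this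
      push Not at this
      obtain ⟨F, hF, h⟩ := this (c / 2) (by positivity)
      exact ⟨F, fun _ => ⟨hF, fun J hJ hPJ => (h J hJ hPJ).le⟩⟩
    · exact ⟨∅, fun h => absurd h hi⟩
  choose F hF using hF
  -- A translate of `F i` captures the average share of any `J ⊆ E`, so sparsity passes from `F i`
  -- to `E` at the cost of a factor `2`. The element `1` only ensures nonemptiness when `s` is
  -- empty.
  obtain ⟨E, hE, hcard⟩ := hΓ.exists_card_inv_mul_le (F := insert 1 (s.biUnion F))
    (Finset.insert_nonempty _ _)
  refine ⟨E, hE, fun i hi J hJE hPJ => ?_⟩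
  obtain ⟨hFi, hsmall⟩ := hF i hi
  rcases J.eq_empty_or_nonempty with rfl | hJ
  · simp only [Finset.card_empty, Nat.cast_zero]
    positivity
  obtain ⟨g, hg⟩ := exists_card_mul_card_le_card_inter_translate hFi hJ
  have h1 : ((J ∩ (F i).image (· * g)).card : ℝ) ≤ c / 2 * (F i).card := by
    have h := hsmall ((J ∩ (F i).image (· * g)).image (· * g⁻¹)) ?_
      (hPt i _ _ (hPm i Finset.inter_subset_left hPJ))
    · rwa [Finset.card_image_of_injective _ (mul_left_injective g⁻¹)] at h
    · intro x hx
      obtain ⟨y, hy, rfl⟩ := Finset.mem_image.1 hx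
      obtain ⟨z, hz, rfl⟩ := Finset.mem_image.1 (Finset.mem_inter.1 hy).2
      simpa using hz
  have h2 : (((F i)⁻¹ * J).card : ℝ) ≤ 2 * E.card := by
    refine le_trans ?_ hcard
    exact_mod_cast Finset.card_le_card (Finset.mul_subset_mul (Finset.inv_subset_inv
      ((Finset.subset_biUnion_of_mem F hi).trans (Finset.subset_insert _ _))) hJE)
  have h3 : (J.card : ℝ) * (F i).card ≤
      (J ∩ (F i).image (· * g)).card * ((F i)⁻¹ * J).card := by exact_mod_cast hg
  have h4 : ((J ∩ (F i).image (· * g)).card : ℝ) * ((F i)⁻¹ * J).card ≤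
      c / 2 * (F i).card * (2 * E.card) := mul_le_mul h1 h2 (by positivity) (by positivity)
  have hFi0 : (0 : ℝ) < (F i).card := by exact_mod_cast hFi.card_pos
  refine le_of_mul_le_mul_right ?_ hFi0
  linarith

end

/-! ### Independence sets and IE-tuples -/

section Independence

variable {Y : Type*} [MulAction Γ Y] {k : ℕ}

lemma IsIndependenceSet.subset {A : Fin k → Set Y} {F F' : Set Γ} (h : IsIndependenceSet A F)
    (hF : F' ⊆ F) : IsIndependenceSet A F' :=
  fun J hJ hJF σ => h J hJ (hJF.trans hF) σ

/-- Colourings of all of `Γ` avoid dependent types and subsets of `J`. Nonemptiness of `Y` matters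
only for `J = ∅`, where the definition is vacuous. -/
lemma isIndependenceSet_coe_iff [Nonempty Y] {A : Fin k → Set Y} {J : Finset Γ} :
    IsIndependenceSet A (J : Set Γ) ↔ ∀ σ : Γ → Fin k, ∃ y : Y, ∀ s ∈ J, s • y ∈ A (σ s) := by
  classical
  constructor
  · intro h σ
    rcases J.eq_empty_or_nonempty with rfl | hJ
    · obtain ⟨y⟩ := (inferInstance : Nonempty Y)
      exact ⟨y, by simp⟩
    · obtain ⟨y, hy⟩ := h J hJ subset_rfl fun s => σ s
      exact ⟨y, fun s hs => Set.mem_iInter.1 hy ⟨s, hs⟩⟩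
  · intro h I hI hIJ σ
    obtain ⟨i, hi⟩ := hI
    obtain ⟨y, hy⟩ := h fun s => if hs : s ∈ I then σ ⟨s, hs⟩ else σ ⟨i, hi⟩
    refine ⟨y, Set.mem_iInter.2 fun s => ?_⟩
    have := hy s (hIJ s.2)
    rwa [dif_pos s.2] at this

lemma IsIndependenceSet.image_mul_right [DecidableEq Γ] {A : Fin k → Set Y} {J : Finset Γ}
    (h : IsIndependenceSet A (J : Set Γ)) (g : Γ) :
    IsIndependenceSet A ((J.image (· * g) : Finset Γ) : Set Γ) := by
  rcases J.eq_empty_or_nonempty with rfl | hJ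
  · simpa using h
  by_cases hY : Nonempty Y
  · rw [isIndependenceSet_coe_iff] at h ⊢
    intro σ
    obtain ⟨y, hy⟩ := h fun s => σ (s * g)
    refine ⟨g⁻¹ • y, fun s hs => ?_⟩
    obtain ⟨t, ht, rfl⟩ := Finset.mem_image.1 hs
    simpa [mul_smul] using hy t ht
  · intro I hI _ σ
    obtain ⟨i, hi⟩ := hI
    obtain ⟨y, -⟩ := h J hJ subset_rfl fun _ => σ ⟨i, hi⟩
    exact absurd ⟨y⟩ hY

lemma IsIndependenceSet.mono {A B : Fin k → Set Y} {F : Set Γ} (h : IsIndependenceSet A F)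
    (hAB : ∀ j, A j ⊆ B j) : IsIndependenceSet B F := by
  intro J hJ hJF σ
  obtain ⟨y, hy⟩ := h J hJ hJF σ
  exact ⟨y, Set.mem_iInter.2 fun s => hAB _ (Set.mem_iInter.1 hy s)⟩

lemma isIndependenceSet_empty (A : Fin k → Set Y) : IsIndependenceSet A (∅ : Set Γ) := by
  intro J hJ hJF
  obtain ⟨i, hi⟩ := hJ
  exact absurd (hJF hi) (Set.notMem_empty i)

lemma independenceDensity_pos_iff {A : Fin k → Set Y} :
    0 < independenceDensity Γ A ↔
      HasPositiveDensity fun J : Finset Γ => IsIndependenceSet A (J : Set Γ) := by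
  classical
  have hne : Nonempty {F : Finset Γ // F.Nonempty} := ⟨⟨{1}, Finset.singleton_nonempty 1⟩⟩
  have hbdd : BddBelow (Set.range fun F : {F : Finset Γ // F.Nonempty} =>
      (maxIndependentCard Γ A F.1 : ℝ) / (F.1.card : ℝ)) :=
    ⟨0, by rintro _ ⟨F, rfl⟩; positivity⟩
  constructor
  · intro h
    refine ⟨_, h, fun F hF => ?_⟩
    obtain ⟨J, hJ, hmax⟩ := Finset.exists_mem_eq_sup
      (F.powerset.filter fun J : Finset Γ => IsIndependenceSet A (J : Set Γ))
      ⟨∅, by simpa using isIndependenceSet_empty A⟩ Finset.card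
    rw [Finset.mem_filter, Finset.mem_powerset] at hJ
    refine ⟨J, hJ.1, hJ.2, ?_⟩
    have h1 := ciInf_le hbdd ⟨F, hF⟩
    rw [le_div_iff₀ (by exact_mod_cast hF.card_pos)] at h1
    refine h1.trans ?_
    rw [maxIndependentCard, hmax]
  · rintro ⟨c, hc, h⟩
    refine hc.trans_le (le_ciInf fun F => ?_)
    obtain ⟨J, hJ, hind, hcard⟩ := h F.1 F.2
    rw [le_div_iff₀ (by exact_mod_cast F.2.card_pos)]
    refine hcard.trans ?_
    have : J.card ≤ maxIndependentCard Γ A F.1 :=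
      Finset.le_sup (f := Finset.card) (Finset.mem_filter.2 ⟨Finset.mem_powerset.2 hJ, hind⟩)
    exact_mod_cast this

lemma mem_IETuples_iff [TopologicalSpace Y] {y : Fin k → Y} :
    y ∈ IETuples Γ k Y ↔ ∀ U : Fin k → Set Y, (∀ j, U j ∈ 𝓝 (y j)) →
      HasPositiveDensity fun J : Finset Γ => IsIndependenceSet U (J : Set Γ) := by
  simp only [IETuples, Set.mem_ofPred_eq, independenceDensity_pos_iff]

/-- Neighbourhoods that witness failure at `y` are also neighbourhoods of the coordinates of every
nearby tuple. -/
lemma isClosed_IETuples [TopologicalSpace Y] : IsClosed (IETuples Γ k Y) := by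
  rw [← isOpen_compl_iff, isOpen_iff_mem_nhds]
  intro y hy
  rw [Set.mem_compl_iff, mem_IETuples_iff] at hy
  push Not at hy
  obtain ⟨U, hU, hd⟩ := hy
  filter_upwards [set_pi_mem_nhds Set.finite_univ fun j _ => eventually_mem_nhds_iff.2 (hU j)]
    with z hz hzI
  exact hd (mem_IETuples_iff.1 hzI U fun j => hz j (Set.mem_univ j))

end Independence

end Density

/-! ### Measures as functionals, and Hahn–Banach separation -/

section Measures

lemma integral_smul_probabilityMeasure {Γ X : Type*} [Group Γ]
    [TopologicalSpace X] [MeasurableSpace X] [BorelSpace X] [MulAction Γ X]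
    [ContinuousConstSMul Γ X] (s : Γ) (μ : ProbabilityMeasure X) (f : C(X, ℝ)) :
    ∫ x, f x ∂((s • μ : ProbabilityMeasure X) : Measure X) = ∫ x, f (s • x) ∂(μ : Measure X) :=
  integral_map (measurable_const_smul s).aemeasurable
    f.continuous.stronglyMeasurable.aestronglyMeasurable
variable {X : Type*} [TopologicalSpace X] [CompactSpace X] [MeasurableSpace X] [BorelSpace X]

lemma integrable_continuousMap (μ : ProbabilityMeasure X) (f : C(X, ℝ)) :
    Integrable (fun x => f x) (μ : Measure X) :=
  (BoundedContinuousFunction.mkOfCompact f).integrable (μ : Measure X)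

lemma measureFunctional_apply (μ : ProbabilityMeasure X) (f : C(X, ℝ)) :
    measureFunctional μ f = ∫ x, f x ∂(μ : Measure X) := rfl

lemma measureFunctional_diracProba (x : X) (f : C(X, ℝ)) :
    measureFunctional (diracProba x) f = f x := by
  rw [measureFunctional_apply]
  exact integral_dirac' _ _ f.continuous.stronglyMeasurable

lemma continuous_measureFunctionalTuple {k : ℕ} :
    Continuous (measureFunctionalTuple : (Fin k → ProbabilityMeasure X) → _) :=
  continuous_pi fun j => WeakDual.continuous_of_continuous_eval fun f =>
    (ProbabilityMeasure.continuous_integral_continuousMap f).comp (continuous_apply j)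

lemma measureFunctionalTuple_injective [TopologicalSpace.MetrizableSpace X] {k : ℕ} :
    Function.Injective (measureFunctionalTuple : (Fin k → ProbabilityMeasure X) → _) := by
  intro μ ν h
  funext j
  refine Subtype.ext ?_
  have hμ : IsFiniteMeasure (μ j : Measure X) := inferInstance
  have hν : IsFiniteMeasure (ν j : Measure X) := inferInstance
  refine @ext_of_forall_integral_eq_of_IsFiniteMeasure _ _ _ _ _ _ _ hμ hν fun f => ?_
  exact DFunLike.congr_fun (congrFun h j) f.toContinuousMap

/-- A continuous functional on a power of the weak-* dual is given by a tuple of vectors. -/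
lemma exists_eq_sum_apply_of_strongDual {E : Type*} [NormedAddCommGroup E] [NormedSpace ℝ E] {k : ℕ}
    (F : StrongDual ℝ (Fin k → WeakDual ℝ E)) :
    ∃ f : Fin k → E, ∀ φ, F φ = ∑ j, φ j (f j) := by
  have h : ∀ j, ∃ f : E, ∀ φ : WeakDual ℝ E, F (Pi.single j φ) = φ f := by
    intro j
    obtain ⟨f, hf⟩ := LinearMap.dualEmbedding_surjective (topDualPairing ℝ E)
      (F.comp (ContinuousLinearMap.single ℝ (fun _ => WeakDual ℝ E) j))
    exact ⟨f, fun φ => (DFunLike.congr_fun hf φ).symm⟩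
  choose f hf using h
  refine ⟨f, fun φ => ?_⟩
  conv_lhs => rw [← Finset.univ_sum_single φ]
  rw [map_sum]
  exact Finset.sum_congr rfl fun j _ => hf j (φ j)

/-- Separation of a point from a closed convex set in a power of the weak-* dual. -/
lemma exists_separating_tuple {E : Type*} [NormedAddCommGroup E] [NormedSpace ℝ E] {k : ℕ}
    {K : Set (Fin k → WeakDual ℝ E)} (hc : Convex ℝ K) (hK : IsClosed K)
    {φ : Fin k → WeakDual ℝ E} (hφ : φ ∉ K) :
    ∃ (f : Fin k → E) (u : ℝ), (∀ ψ ∈ K, ∑ j, ψ j (f j) < u) ∧ u < ∑ j, φ j (f j) := by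
  have : LocallyConvexSpace ℝ (WeakDual ℝ E) :=
    inferInstanceAs (LocallyConvexSpace ℝ (WeakBilin (topDualPairing ℝ E)))
  obtain ⟨F, u, h1, h2⟩ := geometric_hahn_banach_closed_point hc hK hφ
  obtain ⟨f, hf⟩ := exists_eq_sum_apply_of_strongDual F
  exact ⟨f, u, fun ψ hψ => hf ψ ▸ h1 ψ hψ, hf φ ▸ h2⟩

end Measures

/-! ### The separation estimate for IE-tuples of measures -/

section Main

variable {Γ X : Type*} [Group Γ] [TopologicalSpace X] [CompactSpace X]
  [TopologicalSpace.MetrizableSpace X] [MulAction Γ X]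

/-- A compact set of tuples without IE-tuples can be covered by boxes from a finite cover of `X` by
compact sets, none of which has positive independence density. -/
lemma exists_finite_cover_not_hasPositiveDensity {k : ℕ} {C : Set (Fin k → X)} (hC : IsClosed C)
    (hdisj : ∀ x ∈ C, x ∉ IETuples Γ k X) :
    ∃ (t : Finset X) (V : t → Set X), (∀ a, IsCompact (V a)) ∧ (∀ a, (V a).Nonempty) ∧
      (∀ x, ∃ a, x ∈ V a) ∧ ∀ v : Fin k → t, (∃ y ∈ C, ∀ j, y j ∈ V (v j)) →
        ¬ HasPositiveDensity fun J : Finset Γ =>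
          IsIndependenceSet (fun j => V (v j)) (J : Set Γ) := by
  let _ := TopologicalSpace.metrizableSpaceMetric X
  have h : ∀ x : C, ∃ U : Fin k → Set X, (∀ j, U j ∈ 𝓝 (x.1 j)) ∧
      ¬ HasPositiveDensity fun J : Finset Γ => IsIndependenceSet U (J : Set Γ) := by
    intro x
    have := hdisj x.1 x.2
    rw [mem_IETuples_iff] at this
    push Not at this
    exact this
  choose U hU hUd using h
  -- With a Lebesgue number `δ` and closed balls of radius `δ / 3`, a box meeting `C` at `y` stays
  -- within `δ` of `y`, hence inside one of the boxes `U x` of zero density.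
  obtain ⟨δ, hδ, hleb⟩ := lebesgue_number_lemma_of_metric (s := C)
    (c := fun x : C => interior (Set.univ.pi (U x))) hC.isCompact (fun _ => isOpen_interior)
    (fun x hx => Set.mem_iUnion.2 ⟨⟨x, hx⟩, mem_interior_iff_mem_nhds.2
      (set_pi_mem_nhds Set.finite_univ fun j _ => hU ⟨x, hx⟩ j)⟩)
  obtain ⟨t, -, htf, ht⟩ := finite_cover_balls_of_compact (isCompact_univ (X := X))
    (show 0 < δ / 3 by positivity)
  refine ⟨htf.toFinset, fun a => Metric.closedBall a.1 (δ / 3),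
    fun a => Metric.isClosed_closedBall.isCompact,
    fun a => ⟨a.1, Metric.mem_closedBall_self (by positivity)⟩, fun x => ?_, ?_⟩
  · obtain ⟨a, ha, hxa⟩ := Set.mem_iUnion₂.1 (ht (Set.mem_univ x))
    exact ⟨⟨a, htf.mem_toFinset.2 ha⟩, Metric.ball_subset_closedBall hxa⟩
  · rintro v ⟨y, hyC, hy⟩ hpos
    obtain ⟨x, hx⟩ := hleb y hyC
    refine hUd x (hpos.mono fun J hJ => hJ.mono fun j p hp => ?_)
    -- Changing only the `j`-th coordinate of `y` suffices, since inclusion in a box is tested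
    -- coordinatewise.
    have hmem : Function.update y j p ∈ Metric.ball y δ := by
      rw [Metric.mem_ball, dist_pi_lt_iff hδ]
      intro i
      rcases eq_or_ne i j with rfl | hij
      · rw [Function.update_self]
        have h1 := Metric.mem_closedBall.1 hp
        have h2 := Metric.mem_closedBall'.1 (hy i)
        have := dist_triangle p (v i).1 (y i)
        linarith
      · rw [Function.update_of_ne hij, dist_self]
        exact hδ
    simpa using interior_subset (hx hmem) j (Set.mem_univ j)

variable [MeasurableSpace X] [BorelSpace X] [ContinuousConstSMul Γ X]

/-- A tuple of continuous functions whose sum is bounded by `u` on IE-tuples of points has integral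
sum at most `u` on IE-tuples of measures. -/
lemma sum_integral_le_of_mem_IETuples (hΓ : IsAmenableGroup Γ) {k : ℕ} (hk : 1 ≤ k)
    {μ : Fin k → ProbabilityMeasure X} (hμ : μ ∈ IETuples Γ k (ProbabilityMeasure X))
    (f : Fin k → C(X, ℝ)) (u : ℝ) (hf : ∀ x ∈ IETuples Γ k X, ∑ j, f j (x j) < u) :
    ∑ j, ∫ x, f j x ∂(μ j : Measure X) ≤ u := by
  classical
  by_contra! hcon
  have : Nonempty (Fin k) := ⟨⟨0, hk⟩⟩
  have hk0 : (0 : ℝ) < k := by exact_mod_cast hk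
  set a : Fin k → ℝ := fun j => ∫ x, f j x ∂(μ j : Measure X) with ha
  set η : ℝ := (∑ j, a j - u) / 2 with hη
  have hη0 : 0 < η := by rw [hη]; linarith
  set ε : ℝ := η / k with hε
  have hε0 : 0 < ε := div_pos hη0 hk0
  -- Normalised so that `∫ g j > 0` for measures near `μ j`, while `∑ j, g j (y j) ≤ -η` off `C`:
  -- the shifts add up to `η - ∑ j, a j = -u - η`.
  set g : Fin k → X → ℝ := fun j x => f j x + (ε - a j) with hg
  have hgsum : ∀ y : Fin k → X, ∑ j, f j (y j) < u → ∑ j, g j (y j) ≤ -η := by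
    intro y hy
    have : ∑ j, g j (y j) = ∑ j, f j (y j) + (η - ∑ j, a j) := by
      simp only [hg, Finset.sum_add_distrib, Finset.sum_sub_distrib, Finset.sum_const,
        Finset.card_univ, Fintype.card_fin, nsmul_eq_mul, hε, mul_div_cancel₀ η hk0.ne']
    rw [this]
    linarith
  have hgc : ∀ j, Continuous (g j) := fun j =>
    (f j).continuous.add continuous_const
  set C : Set (Fin k → X) := {y | u ≤ ∑ j, f j (y j)} with hC
  have hCclosed : IsClosed C := isClosed_le continuous_const
    (continuous_finsetSum _ fun j _ => (f j).continuous.comp (continuous_apply j))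
  obtain ⟨t, V, hVc, hVn, hVcov, hVd⟩ := exists_finite_cover_not_hasPositiveDensity (Γ := Γ)
    hCclosed fun x hx hxI => (hf x hxI).not_ge hx
  -- Each letter is given the maximum of `g j` over its cover element, so replacing points by
  -- letters never decreases the sums.
  have hmax : ∀ (j : Fin k) (b : t), ∃ p ∈ V b, ∀ q ∈ V b, g j q ≤ g j p := fun j b =>
    (hVc b).exists_isMaxOn (hVn b) (hgc j).continuousOn
  choose p hp hpmax using hmax
  choose b hb using hVcov
  obtain ⟨c, hc, hpat⟩ := exists_pattern_of_sum_nonneg (fun j b => g j (p j b))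
    (Finset.univ.filter fun v : Fin k → t => ∃ y ∈ C, ∀ j, y j ∈ V (v j)) hη0 fun v hv =>
      hgsum (fun j => p j (v j)) (by
        by_contra! h
        exact hv (Finset.mem_filter.2 ⟨Finset.mem_univ _, _, h, fun j => hp j (v j)⟩))
  obtain ⟨d, hd, hind⟩ := mem_IETuples_iff.1 hμ
    (fun j => {ν : ProbabilityMeasure X | a j - ε < ∫ x, f j x ∂(ν : Measure X)}) fun j =>
      (isOpen_lt continuous_const
        (ProbabilityMeasure.continuous_integral_continuousMap (f j))).mem_nhds
        (show a j - ε < a j by linarith)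
  -- The pattern found below occupies at least `c * d * |E|` elements of `E`; the threshold `c * d /
  -- 2` contradicts this.
  obtain ⟨E, hE, hsparse⟩ := exists_forall_card_le_of_not_hasPositiveDensity hΓ
    (Finset.univ.filter fun v : Fin k → t => ∃ y ∈ C, ∀ j, y j ∈ V (v j))
    (P := fun v J => IsIndependenceSet (fun j => V (v j)) (J : Set Γ))
    (fun v hv => hVd v (Finset.mem_filter.1 hv).2)
    (fun v I J hIJ hJ => hJ.subset (Finset.coe_subset.2 hIJ))
    (fun v J γ hJ => hJ.image_mul_right γ) (show 0 < c * d / 2 by positivity)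
  have hE0 : (0 : ℝ) < E.card := by exact_mod_cast hE.card_pos
  obtain ⟨J, hJE, hJ, hJcard⟩ := hind E hE
  have hJ0 : J.Nonempty := by
    rw [← Finset.card_pos]
    exact_mod_cast (mul_pos hd hE0).trans_le hJcard
  have : Nonempty (ProbabilityMeasure X) := ⟨μ ⟨0, hk⟩⟩
  have hpt : ∀ σ : J → Fin k, ∃ x : X, 0 ≤ ∑ s : J, g (σ s) ((s : Γ) • x) := by
    intro σ
    obtain ⟨ν, hν⟩ := hJ J hJ0 subset_rfl σ
    have hint : ∀ s : J, Integrable (fun x => g (σ s) ((s : Γ) • x)) (ν : Measure X) := fun s =>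
      integrable_continuousMap ν
        ⟨fun x => g (σ s) ((s : Γ) • x), (hgc _).comp (continuous_const_smul _)⟩
    -- Some point does at least as well as the average over `ν`.
    obtain ⟨x, hx⟩ := exists_integral_le (μ := (ν : Measure X))
      (integrable_finsetSum Finset.univ fun s _ => hint s)
    refine ⟨x, le_trans ?_ hx⟩
    rw [integral_finsetSum _ fun s _ => hint s]
    refine Finset.sum_nonneg fun s _ => ?_
    have h1 : a (σ s) - ε < ∫ x, f (σ s) x ∂(((s : Γ) • ν : ProbabilityMeasure X) : Measure X) :=
      Set.mem_iInter.1 hν s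
    rw [integral_smul_probabilityMeasure] at h1
    have hfi : Integrable (fun x => f (σ s) ((s : Γ) • x)) (ν : Measure X) :=
      integrable_continuousMap ν
        ⟨fun x => f (σ s) ((s : Γ) • x), (f (σ s)).continuous.comp (continuous_const_smul _)⟩
    have h2 : ∫ x, g (σ s) ((s : Γ) • x) ∂(ν : Measure X) =
        ∫ x, f (σ s) ((s : Γ) • x) ∂(ν : Measure X) + (ε - a (σ s)) := by
      simp only [hg]
      rw [integral_add hfi (integrable_const _)]
      simp
    linarith
  choose x hx using hpt
  have hJne : Nonempty J := hJ0.to_subtype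
  obtain ⟨v, hv, W, hW, hτ⟩ := hpat J (fun σ s => b ((s : Γ) • x σ)) fun σ =>
    (hx σ).trans (Finset.sum_le_sum fun s _ => hpmax _ _ _ (hb _))
  have : Nonempty X := ⟨x fun _ => ⟨0, hk⟩⟩
  have hWind : IsIndependenceSet (fun j => V (v j))
      ((W.map (Function.Embedding.subtype _) : Finset Γ) : Set Γ) := by
    rw [isIndependenceSet_coe_iff]
    intro τ
    obtain ⟨σ, hσ⟩ := hτ fun s => τ s
    refine ⟨x σ, fun s hs => ?_⟩
    obtain ⟨r, hr, rfl⟩ := Finset.mem_map.1 hs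
    have := hb ((r : Γ) • x σ)
    rw [hσ r hr] at this
    exact this
  have h1 := hsparse v hv _ (fun s hs => by
    obtain ⟨s, -, rfl⟩ := Finset.mem_map.1 hs
    exact hJE s.2) hWind
  rw [Finset.card_map] at h1
  rw [Fintype.card_coe] at hW
  have h2 := mul_le_mul_of_nonneg_left hJcard hc.le
  have h3 : 0 < c * d * E.card := by positivity
  linarith

end Main

/-! ### Convexity of the set of IE-tuples of measures -/

section Mixtures

/-- The convex combination `a μ + b ν` of probability measures. -/
noncomputable def mixture {Z : Type*} [MeasurableSpace Z] {a b : ℝ≥0} (hab : a + b = 1)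
    (μ ν : ProbabilityMeasure Z) : ProbabilityMeasure Z :=
  ⟨a • (μ : Measure Z) + b • (ν : Measure Z), ⟨by
    rw [Measure.add_apply, Measure.smul_apply, Measure.smul_apply, measure_univ, measure_univ,
      ENNReal.smul_def, ENNReal.smul_def, smul_eq_mul, smul_eq_mul, mul_one, mul_one]
    exact_mod_cast hab⟩⟩

lemma integral_mixture {Z : Type*} [MeasurableSpace Z] {a b : ℝ≥0} (hab : a + b = 1)
    {μ ν : ProbabilityMeasure Z} {f : Z → ℝ} (hμ : Integrable f (μ : Measure Z))
    (hν : Integrable f (ν : Measure Z)) :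
    ∫ z, f z ∂(mixture hab μ ν : Measure Z) =
      a * ∫ z, f z ∂(μ : Measure Z) + b * ∫ z, f z ∂(ν : Measure Z) := by
  change ∫ z, f z ∂(a • (μ : Measure Z) + b • (ν : Measure Z)) = _
  rw [integral_add_measure (hμ.smul_measure_nnreal) (hν.smul_measure_nnreal),
    integral_smul_nnreal_measure, integral_smul_nnreal_measure]
  rfl

variable {Γ X : Type*} [Group Γ] [TopologicalSpace X] [MeasurableSpace X] [BorelSpace X]
  [MulAction Γ X] [ContinuousConstSMul Γ X] {a b : ℝ≥0} (hab : a + b = 1)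

lemma smul_mixture (s : Γ) (μ ν : ProbabilityMeasure X) :
    s • mixture hab μ ν = mixture hab (s • μ) (s • ν) := by
  apply Subtype.ext
  change (a • (μ : Measure X) + b • (ν : Measure X)).map (fun x : X => s • x) =
    a • (μ : Measure X).map (fun x : X => s • x) + b • (ν : Measure X).map (fun x : X => s • x)
  rw [Measure.map_add _ _ (measurable_const_smul s), Measure.map_smul, Measure.map_smul]

lemma smul_diracProba (s : Γ) (x : X) : s • diracProba x = diracProba (s • x) :=
  Subtype.ext (Measure.map_dirac' (measurable_const_smul s) x)

lemma diracTuple_mem_IETuples {k : ℕ} {x : Fin k → X} (hx : x ∈ IETuples Γ k X) :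
    diracTuple x ∈ IETuples Γ k (ProbabilityMeasure X) := by
  rw [mem_IETuples_iff] at hx ⊢
  intro U hU
  refine (hx (fun j => diracProba ⁻¹' U j)
    fun j => continuous_diracProba.continuousAt (hU j)).mono fun J hJ I hI hIJ σ => ?_
  obtain ⟨y, hy⟩ := hJ I hI hIJ σ
  refine ⟨diracProba y, Set.mem_iInter.2 fun s => ?_⟩
  have := Set.mem_iInter.1 hy s
  simpa only [Set.mem_preimage, smul_diracProba] using this

variable [CompactSpace X]

lemma continuous_mixture :
    Continuous fun p : ProbabilityMeasure X × ProbabilityMeasure X => mixture hab p.1 p.2 := by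
  rw [ProbabilityMeasure.continuous_iff_forall_continuousMap_continuous_integral]
  intro f
  simp only [integral_mixture hab (integrable_continuousMap _ f) (integrable_continuousMap _ f)]
  exact (continuous_const.mul ((ProbabilityMeasure.continuous_integral_continuousMap f).comp
    continuous_fst)).add (continuous_const.mul
      ((ProbabilityMeasure.continuous_integral_continuousMap f).comp continuous_snd))

/-- Mixing is continuous and equivariant, so on a set independent for neighbourhoods of both tuples
the mixtures of realising measures realise every colouring near the mixed tuple. -/
lemma mixture_mem_IETuples (hΓ : IsAmenableGroup Γ) {k : ℕ} (hk : 1 ≤ k)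
    {μ ν : Fin k → ProbabilityMeasure X} (hμ : μ ∈ IETuples Γ k (ProbabilityMeasure X))
    (hν : ν ∈ IETuples Γ k (ProbabilityMeasure X)) :
    (fun j => mixture hab (μ j) (ν j)) ∈ IETuples Γ k (ProbabilityMeasure X) := by
  classical
  have : Nonempty (ProbabilityMeasure X) := ⟨μ ⟨0, hk⟩⟩
  rw [mem_IETuples_iff] at hμ hν ⊢
  intro U hU
  have h : ∀ j, ∃ V ∈ 𝓝 (μ j), ∃ W ∈ 𝓝 (ν j), ∀ p ∈ V, ∀ q ∈ W, mixture hab p q ∈ U j := by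
    intro j
    have := (continuous_mixture hab).continuousAt (x := (μ j, ν j)) (hU j)
    obtain ⟨V, hV, W, hW, hVW⟩ := mem_nhds_prod_iff.1 this
    exact ⟨V, hV, W, hW, fun p hp q hq => hVW (Set.mk_mem_prod hp hq)⟩
  choose V hV W hW hVW using h
  refine (HasPositiveDensity.and hΓ (hμ V hV) (hν W hW)
    (fun I J hIJ hJ => hJ.subset (Finset.coe_subset.2 hIJ))
    (fun I J hIJ hJ => hJ.subset (Finset.coe_subset.2 hIJ))
    (fun J g hJ => hJ.image_mul_right g)).mono fun J hJ => ?_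
  rw [isIndependenceSet_coe_iff, isIndependenceSet_coe_iff] at hJ
  rw [isIndependenceSet_coe_iff]
  intro σ
  obtain ⟨p, hp⟩ := hJ.1 σ
  obtain ⟨q, hq⟩ := hJ.2 σ
  refine ⟨mixture hab p q, fun s hs => ?_⟩
  rw [smul_mixture]
  exact hVW _ _ (hp s hs) _ (hq s hs)

lemma measureFunctionalTuple_mixture {k : ℕ} (μ ν : Fin k → ProbabilityMeasure X) :
    measureFunctionalTuple (fun j => mixture hab (μ j) (ν j)) =
      (a : ℝ) • measureFunctionalTuple μ + (b : ℝ) • measureFunctionalTuple ν := by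
  funext j
  exact DFunLike.ext _ _ fun f =>
    integral_mixture hab (integrable_continuousMap _ f) (integrable_continuousMap _ f)

lemma convex_image_IETuples (hΓ : IsAmenableGroup Γ) {k : ℕ} (hk : 1 ≤ k) :
    Convex ℝ (measureFunctionalTuple '' IETuples Γ k (ProbabilityMeasure X)) := by
  rintro _ ⟨μ, hμ, rfl⟩ _ ⟨ν, hν, rfl⟩ a b ha hb hab
  lift a to ℝ≥0 using ha
  lift b to ℝ≥0 using hb
  have hab' : a + b = 1 := by exact_mod_cast hab
  exact ⟨_, mixture_mem_IETuples hab' hΓ hk hμ hν, measureFunctionalTuple_mixture hab' μ ν⟩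

end Mixtures

/-! ### Marginals of measures on a set of tuples, and extreme points -/

section Marginals

variable {X : Type*} [TopologicalSpace X] [CompactSpace X] [MeasurableSpace X]
  [BorelSpace X] {k : ℕ}

/-- The functionals given by the marginals of a measure on a set of tuples. -/
noncomputable def marginalFunctional {S : Set (Fin k → X)} (μ : ProbabilityMeasure S) :
    Fin k → WeakDual ℝ C(X, ℝ) :=
  measureFunctionalTuple (marginalTuple (extendMeasure μ))

lemma marginalFunctional_apply {S : Set (Fin k → X)} (μ : ProbabilityMeasure S) (j : Fin k)
    (f : C(X, ℝ)) : marginalFunctional μ j f = ∫ z : S, f (z.1 j) ∂(μ : Measure S) := by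
  have h1 : AEMeasurable (fun z : S => (z : Fin k → X)) (μ : Measure S) :=
    measurable_subtype_coe.aemeasurable
  change ∫ x, f x ∂(((μ : Measure S).map fun z : S => (z : Fin k → X)).map
    fun x : Fin k → X => x j) = _
  rw [integral_map (measurable_pi_apply j).aemeasurable
    f.continuous.stronglyMeasurable.aestronglyMeasurable, integral_map h1]
  exact (f.continuous.measurable.comp (measurable_pi_apply j)).aestronglyMeasurable

lemma integrable_coordinate {S : Set (Fin k → X)} (μ : ProbabilityMeasure S) (j : Fin k)
    (f : C(X, ℝ)) : Integrable (fun z : S => f (z.1 j)) (μ : Measure S) := by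
  refine Integrable.of_bound (C := ‖f‖) ?_ (Filter.Eventually.of_forall fun z => f.norm_coe_le_norm _)
  exact (f.continuous.measurable.comp
    ((measurable_pi_apply j).comp measurable_subtype_coe)).aestronglyMeasurable

lemma marginalFunctional_mixture {S : Set (Fin k → X)} {a b : ℝ≥0} (hab : a + b = 1)
    (μ ν : ProbabilityMeasure S) : marginalFunctional (mixture hab μ ν) =
      (a : ℝ) • marginalFunctional μ + (b : ℝ) • marginalFunctional ν := by
  funext j
  refine DFunLike.ext _ _ fun f => ?_
  change _ = (a : ℝ) * marginalFunctional μ j f + b * marginalFunctional ν j f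
  simp only [marginalFunctional_apply]
  exact integral_mixture hab (integrable_coordinate _ j f) (integrable_coordinate _ j f)

lemma convex_range_marginalFunctional {S : Set (Fin k → X)} :
    Convex ℝ (Set.range (marginalFunctional : ProbabilityMeasure S → _)) := by
  rintro _ ⟨μ, rfl⟩ _ ⟨ν, rfl⟩ a b ha hb hab
  lift a to ℝ≥0 using ha
  lift b to ℝ≥0 using hb
  have hab' : a + b = 1 := by exact_mod_cast hab
  exact ⟨_, marginalFunctional_mixture hab' μ ν⟩

/-- Needed so that the product σ-algebra on `X^k` is its Borel σ-algebra. -/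
lemma secondCountableTopology_of_compact_metrizable (Y : Type*) [TopologicalSpace Y]
    [CompactSpace Y] [TopologicalSpace.MetrizableSpace Y] : SecondCountableTopology Y := by
  let _ := TopologicalSpace.metrizableSpaceMetric Y
  infer_instance

lemma isClosed_range_marginalFunctional [TopologicalSpace.MetrizableSpace X]
    {S : Set (Fin k → X)} (hS : IsClosed S) :
    IsClosed (Set.range (marginalFunctional : ProbabilityMeasure S → _)) := by
  have := secondCountableTopology_of_compact_metrizable X
  have := isCompact_iff_compactSpace.1 hS.isCompact
  have hcont : Continuous (marginalFunctional : ProbabilityMeasure S → _) := by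
    refine continuous_pi fun j => WeakDual.continuous_of_continuous_eval fun f => ?_
    simp only [marginalFunctional_apply]
    exact ProbabilityMeasure.continuous_integral_continuousMap
      (⟨fun z => f (z.1 j),
        f.continuous.comp ((continuous_apply j).comp continuous_subtype_val)⟩ : C(S, ℝ))
  exact (isCompact_range hcont).isClosed

lemma marginalFunctional_diracProba {S : Set (Fin k → X)} (z : S) :
    marginalFunctional (diracProba z) = measureFunctionalTuple (diracTuple z.1) := by
  funext j
  refine DFunLike.ext _ _ fun f => ?_
  rw [marginalFunctional_apply]
  refine (integral_dirac' (fun z : S => f (z.1 j)) z ?_).trans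
    (measureFunctional_diracProba (z.1 j) f).symm
  exact (f.continuous.measurable.comp
    ((measurable_pi_apply j).comp measurable_subtype_coe)).stronglyMeasurable

/-- A separating tuple `f` would satisfy `∑ j, f j (z j) < u` at every point of `S`, and integrating
this bound contradicts separation. -/
lemma marginalFunctional_mem_closedConvexHull {S : Set (Fin k → X)} (μ : ProbabilityMeasure S) :
    marginalFunctional μ ∈ closedConvexHull ℝ (measureFunctionalTuple '' (diracTuple '' S)) := by
  by_contra hμ
  obtain ⟨f, u, h1, h2⟩ := exists_separating_tuple convex_closedConvexHull
    isClosed_closedConvexHull hμ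
  refine h2.not_ge ?_
  simp only [marginalFunctional_apply]
  rw [← integral_finsetSum _ fun j _ => integrable_coordinate μ j (f j)]
  refine (integral_mono (integrable_finsetSum _ fun j _ => integrable_coordinate μ j (f j))
    (integrable_const u) fun z => ?_).trans_eq (by simp)
  have := h1 _ (subset_closedConvexHull ⟨_, ⟨z.1, z.2, rfl⟩, rfl⟩)
  refine le_trans (le_of_eq ?_) this.le
  exact Finset.sum_congr rfl fun j _ => (measureFunctional_diracProba (z.1 j) (f j)).symm

/-- Tuples of Dirac measures are extreme among all tuples of probability measures. -/
lemma eq_of_diracTuple_mem_openSegment {x : Fin k → X} {μ ν : Fin k → ProbabilityMeasure X}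
    (h : measureFunctionalTuple (diracTuple x) ∈
      openSegment ℝ (measureFunctionalTuple μ) (measureFunctionalTuple ν)) :
    measureFunctionalTuple μ = measureFunctionalTuple (diracTuple x) := by
  obtain ⟨a, b, ha, hb, -, h⟩ := h
  funext j
  refine DFunLike.ext _ _ fun f => ?_
  have hx : measureFunctionalTuple (diracTuple x) j f = f (x j) :=
    measureFunctional_diracProba (x j) f
  -- A nonnegative function vanishing at `x j`: its integral against the Dirac mass is zero, hence
  -- so is its integral against `μ j`.
  set g : C(X, ℝ) := ⟨fun y => |f y - f (x j)|, by fun_prop⟩ with hg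
  have h1 : a * ∫ y, g y ∂(μ j : Measure X) + b * ∫ y, g y ∂(ν j : Measure X) = 0 := by
    have := DFunLike.congr_fun (congrFun h j) g
    refine Eq.trans this ((measureFunctional_diracProba (x j) g).trans ?_)
    simp [hg]
  have h2 : 0 ≤ ∫ y, g y ∂(μ j : Measure X) := integral_nonneg fun y => abs_nonneg _
  have h3 : 0 ≤ ∫ y, g y ∂(ν j : Measure X) := integral_nonneg fun y => abs_nonneg _
  have h4 : ∫ y, g y ∂(μ j : Measure X) ≤ 0 := by
    have := mul_nonneg hb.le h3
    by_contra! hpos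
    have := mul_pos ha hpos
    linarith
  rw [hx]
  have h5 : |∫ y, (f y - f (x j)) ∂(μ j : Measure X)| ≤ 0 :=
    (abs_integral_le_integral_abs).trans h4
  rw [integral_sub (integrable_continuousMap _ f) (integrable_const _)] at h5
  have h6 := abs_nonpos_iff.1 h5
  simp only [integral_const, probReal_univ, one_smul] at h6
  exact sub_eq_zero.1 h6

/-- An extreme point of the set of marginals of measures on `S` is a Dirac tuple at a point
of `S`. -/
lemma extremePoints_range_marginalFunctional_subset [TopologicalSpace.MetrizableSpace X]
    {S : Set (Fin k → X)} :
    Set.extremePoints ℝ (Set.range (marginalFunctional : ProbabilityMeasure S → _)) ⊆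
      measureFunctionalTuple '' (diracTuple '' S) := by
  rintro _ ⟨⟨μ, rfl⟩, hext⟩
  have := secondCountableTopology_of_compact_metrizable X
  -- A point of the support of `μ`. The measure `μ` need not be a Dirac mass; only its marginals are
  -- compared with those of `δ_z`.
  obtain ⟨z, -, hz⟩ := exists_mem_forall_mem_nhdsWithin_pos_measure (μ := (μ : Measure S))
    (s := Set.univ) (by simp)
  rw [nhdsWithin_univ] at hz
  have key : ∀ (j : Fin k) (f : C(X, ℝ)), f (z.1 j) ≤ marginalFunctional μ j f := by
    intro j f
    by_contra! hlt
    obtain ⟨m, hm1, hm2⟩ := exists_between hlt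
    have hcont : Continuous fun y : S => f (y.1 j) :=
      f.continuous.comp ((continuous_apply j).comp continuous_subtype_val)
    set B : Set S := {y | m < f (y.1 j)} with hB
    have hBo : IsOpen B := isOpen_lt continuous_const hcont
    have hBm : MeasurableSet B := hBo.measurableSet
    have hBpos : (μ : Measure S) B ≠ 0 := (hz B (hBo.mem_nhds hm2)).ne'
    have hge : ∀ ν : ProbabilityMeasure S, (∀ᵐ y ∂(ν : Measure S), y ∈ B) →
        m ≤ marginalFunctional ν j f := by
      intro ν hν
      rw [marginalFunctional_apply]
      calc m = ∫ _y : S, m ∂(ν : Measure S) := by simp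
        _ ≤ _ := integral_mono_ae (integrable_const m) (integrable_coordinate ν j f)
          (hν.mono fun y hy => le_of_lt hy)
    -- Conditioning on `B` and its complement writes `μ` as a mixture. Extremality forces `μ₁` to
    -- have the marginals of `μ`, yet its integral of `f` is at least `m`.
    by_cases hBc : (μ : Measure S) Bᶜ = 0
    · exact (hge μ (mem_ae_iff.2 hBc)).not_gt hm1
    · have i1 := ProbabilityTheory.cond_isProbabilityMeasure hBpos
      have i2 := ProbabilityTheory.cond_isProbabilityMeasure hBc
      set μ₁ : ProbabilityMeasure S := ⟨ProbabilityTheory.cond (μ : Measure S) B, i1⟩ with hμ₁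
      set μ₂ : ProbabilityMeasure S := ⟨ProbabilityTheory.cond (μ : Measure S) Bᶜ, i2⟩ with hμ₂
      have hab : μ B + μ Bᶜ = 1 := by
        rw [← ENNReal.coe_inj]
        push_cast
        simpa using measure_add_measure_compl (μ := (μ : Measure S)) hBm
      have hmix : mixture hab μ₁ μ₂ = μ := by
        apply Subtype.ext
        refine Measure.ext fun t ht => ?_
        have h := ProbabilityTheory.cond_add_cond_compl_eq (μ := (μ : Measure S)) (t := t) hBm
        refine Eq.trans ?_ h
        change μ B • ProbabilityTheory.cond (μ : Measure S) B t +
          μ Bᶜ • ProbabilityTheory.cond (μ : Measure S) Bᶜ t = _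
        rw [ENNReal.smul_def, ENNReal.smul_def, smul_eq_mul, smul_eq_mul,
          ProbabilityMeasure.ennreal_coeFn_eq_coeFn_toMeasure,
          ProbabilityMeasure.ennreal_coeFn_eq_coeFn_toMeasure, mul_comm, mul_comm ((μ : Measure S) Bᶜ)]
      have hpos : ∀ T : Set S, (μ : Measure S) T ≠ 0 → (0 : ℝ) < (μ T : ℝ≥0) := by
        intro T hT
        have : μ T ≠ 0 := fun h => hT (by
          rw [← ProbabilityMeasure.ennreal_coeFn_eq_coeFn_toMeasure, h, ENNReal.coe_zero])
        exact_mod_cast pos_iff_ne_zero.2 this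
      have heq := hext ⟨μ₁, rfl⟩ ⟨μ₂, rfl⟩ ⟨μ B, μ Bᶜ, hpos B hBpos, hpos Bᶜ hBc,
        by exact_mod_cast hab, by rw [← marginalFunctional_mixture hab, hmix]⟩
      have := hge μ₁ (ProbabilityTheory.ae_cond_mem hBm)
      rw [heq] at this
      exact this.not_gt hm1
  refine ⟨_, ⟨z.1, z.2, rfl⟩, ?_⟩
  funext j
  refine DFunLike.ext _ _ fun f => (measureFunctional_diracProba (z.1 j) f).trans ?_
  refine le_antisymm (key j f) ?_
  -- The inequality for `-f` is the reverse inequality for `f`.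
  have := key j (-f)
  rw [map_neg] at this
  exact neg_le_neg_iff.1 this

end Marginals

/-! ### The theorem -/

theorem theorem1p1 {Γ X : Type*} [Group Γ] [Countable Γ] [Infinite Γ]
    [TopologicalSpace X] [CompactSpace X] [TopologicalSpace.MetrizableSpace X]
    [MeasurableSpace X] [BorelSpace X] [MulAction Γ X] [ContinuousConstSMul Γ X]
    (hΓ : IsAmenableGroup Γ) (k : ℕ) (hk : 1 ≤ k) :
    measureFunctionalTuple '' IETuples Γ k (ProbabilityMeasure X) =
        closedConvexHull ℝ
          (measureFunctionalTuple '' (diracTuple '' IETuples Γ k X)) ∧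
    diracTuple '' IETuples Γ k X =
        IETuples Γ k (ProbabilityMeasure X) ∩
          Set.range (diracTuple : (Fin k → X) → (Fin k → ProbabilityMeasure X)) ∧
    measureFunctionalTuple '' (diracTuple '' IETuples Γ k X) =
        Set.extremePoints ℝ
          (measureFunctionalTuple '' IETuples Γ k (ProbabilityMeasure X)) ∧
    IETuples Γ k (ProbabilityMeasure X) =
        {ν | ∃ μ : ProbabilityMeasure (IETuples Γ k X), ν = marginalTuple (extendMeasure μ)} := by
  have hdirac : diracTuple '' IETuples Γ k X ⊆ IETuples Γ k (ProbabilityMeasure X) := by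
    rintro _ ⟨x, hx, rfl⟩
    exact diracTuple_mem_IETuples hx
  have hhull : measureFunctionalTuple '' IETuples Γ k (ProbabilityMeasure X) =
      closedConvexHull ℝ (measureFunctionalTuple '' (diracTuple '' IETuples Γ k X)) := by
    refine Set.Subset.antisymm ?_ (closedConvexHull_min (Set.image_mono hdirac)
      (convex_image_IETuples hΓ hk) ?_)
    · rintro _ ⟨μ, hμ, rfl⟩
      by_contra hcon
      obtain ⟨f, u, h1, h2⟩ := exists_separating_tuple convex_closedConvexHull
        isClosed_closedConvexHull hcon
      refine h2.not_ge (sum_integral_le_of_mem_IETuples hΓ hk hμ f u fun x hx => ?_)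
      refine lt_of_eq_of_lt ?_ (h1 _ (subset_closedConvexHull ⟨_, ⟨x, hx, rfl⟩, rfl⟩))
      exact Finset.sum_congr rfl fun j _ => (measureFunctional_diracProba (x j) (f j)).symm
    · exact (isClosed_IETuples.isCompact.image continuous_measureFunctionalTuple).isClosed
  have hrange : measureFunctionalTuple '' IETuples Γ k (ProbabilityMeasure X) =
      Set.range (marginalFunctional : ProbabilityMeasure (IETuples Γ k X) → _) := by
    rw [hhull]
    refine Set.Subset.antisymm (closedConvexHull_min ?_ convex_range_marginalFunctional
      (isClosed_range_marginalFunctional isClosed_IETuples)) ?_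
    · rintro _ ⟨_, ⟨x, hx, rfl⟩, rfl⟩
      exact ⟨diracProba ⟨x, hx⟩, marginalFunctional_diracProba _⟩
    · rintro _ ⟨μ, rfl⟩
      exact marginalFunctional_mem_closedConvexHull μ
  have hsub : Set.extremePoints ℝ
      (measureFunctionalTuple '' IETuples Γ k (ProbabilityMeasure X)) ⊆
        measureFunctionalTuple '' (diracTuple '' IETuples Γ k X) := by
    rw [hrange]
    exact extremePoints_range_marginalFunctional_subset
  have hext : ∀ x : Fin k → X, diracTuple x ∈ IETuples Γ k (ProbabilityMeasure X) →
      measureFunctionalTuple (diracTuple x) ∈ Set.extremePoints ℝ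
        (measureFunctionalTuple '' IETuples Γ k (ProbabilityMeasure X)) := by
    refine fun x hx => ⟨⟨_, hx, rfl⟩, ?_⟩
    rintro _ ⟨μ, -, rfl⟩ _ ⟨ν, -, rfl⟩ h
    exact eq_of_diracTuple_mem_openSegment h
  refine ⟨hhull, ?_, ?_, ?_⟩
  · refine Set.Subset.antisymm (Set.subset_inter hdirac (Set.image_subset_range _ _)) ?_
    rintro _ ⟨hx, x, rfl⟩
    -- A Dirac tuple that is an IE-tuple of measures is extreme, so it comes from an IE-tuple of
    -- points.
    exact (measureFunctionalTuple_injective.mem_set_image).1 (hsub (hext x hx))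
  · refine Set.Subset.antisymm ?_ hsub
    rintro _ ⟨_, ⟨x, hx, rfl⟩, rfl⟩
    exact hext x (diracTuple_mem_IETuples hx)
  · ext ν
    rw [← measureFunctionalTuple_injective.mem_set_image, hrange]
    exact ⟨fun ⟨μ, hμ⟩ => ⟨μ, measureFunctionalTuple_injective hμ.symm⟩,
      fun ⟨μ, hμ⟩ => ⟨μ, congrArg measureFunctionalTuple hμ.symm⟩⟩
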